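/- **Setting.** Let $1\le k<n$ and $q\ge 1$ be integers, let $X$ be a real $n\times k$ matrix of rank $k$, $R$ a real $q\times k$ matrix of rank $q$, and $r\in\mathbb{R}^q$. Put $\mathfrak{M}_0=\{X\beta:\beta\in\mathbb{R}^k,\ R\beta=r\}$ and let $\mathfrak{M}_0^{lin}=\mathfrak{M}_0-\mu_0$ ($\mu_0\in\mathfrak{M}_0$) be the linear space parallel to the affine space $\mathfrak{M}_0$. For a matrix $A$, $\operatorname{span}(A)$ denotes its column space. For $y\in\mathbb{R}^n$ let $\hat\beta(y)=(X'X)^{-1}X'y$, $\hat u(y)=y-X\hat\beta(y)$, and $\hat v_t(y)=\hat u_t(y)x_{t\cdot}'$, where $x_{t\cdot}$ is the $t$-th row of $X$. *Test statistic.* For real weights $w(j,n)$, $|j|\le n-1$, let $$\hat\Psi_w(y)=\sum_{j=-(n-1)}^{n-1}w(j,n)\hat\Gamma_j(y),\qquad \hat\Omega_w(y)=nR(X'X)^{-1}\hat\Psi_w(y)(X'X)^{-1}R',$$ where $\hat\Gamma_j(y)=n^{-1}\sum_{t=j+1}^n\hat v_t(y)\hat v_{t-j}(y)'$ for $j\ge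 0$ and $\hat\Gamma_j(y)=\hat\Gamma_{-j}(y)'$ for $j<0$. Let $$T_w(y)=(R\hat\beta(y)-r)'\,\hat\Omega_w(y)^{-1}(R\hat\beta(y)-r)\ \text{ if }\det\hat\Omega_w(y)\ne 0,\qquad T_w(y)=0\ \text{ otherwise.}$$ *Assumptions on the weights and on $(R,X)$.* (W) $w(0,n)=1$, $w(-j,n)=w(j,n)$, and the $n\times n$ matrix with entries $w(i-j,n)$ is positive definite. (RX) If $i_1<\dots<i_s$ are the indices $i$ for which the standard basis vector $e_i$ of $\mathbb{R}^n$ lies in $\operatorname{span}(X)$, and $X'(\neg(i_1,\dots,i_s))$ is $X'$ with the columns $i_1,\dots,i_s$ deleted, then $\operatorname{rank}\big(R(X'X)^{-1}X'(\neg(i_1,\dots,i_s))\big)=q$. *Exceptional set and concentration spaces.* Let $B(y)=R(X'X)^{-1}X'\operatorname{diag}(\hat u_1(y),\dots,\hat u_n(y))$ and $\mathsf{B}=\{y\in\mathbb{R}^n:\operatorname{rank}B(y)<q\}$. For $\omega\in[0,\pi]$ and an integer $s\ge 0$ let $E_{n,s}(\omega)$ be the $n\times 2$ matrix with $j$-th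 row $(j^s\cos(j\omega),j^s\sin(j\omega))$, $1\le j\le n$, and for a linear subspace $\mathcal{L}\subsetneq\mathbb{R}^n$ let $\rho(\omega,\mathcal{L})=\min\{s\in\{0,1,2,\dots\}:\operatorname{span}(E_{n,s}(\omega))\not\subseteq\mathcal{L}\}$. *Covariance model.* $\mathfrak{F}_{\mathrm{all}}$ is the set of all normalized spectral densities of real processes, i.e. of all nonnegative, even, integrable functions $f$ on $[-\pi,\pi]$ with $\int_{-\pi}^{\pi}f(\omega)\,d\omega=1$, and $\Sigma(f)=\left[\int_{-\pi}^{\pi}e^{-\iota(j-l)\omega}f(\omega)\,d\omega\right]_{j,l=1}^n$. *Errors.* Let $H$ be a set of probability densities $h$ on $\mathbb{R}^n$ (with respect to Lebesgue measure) such that a random vector $\mathbf{z}$ with density $h$ has mean zero and unit covariance matrix, for every $h\in H$. Suppose that $H$ has an integrable envelope, i.e. there is a function $h^*$ with $\int h^*(z)\,dz<\infty$ such that, for every $h\in H$, $h(z)\le h^*(z)$ for almost every $z$. Let $\mathcal{D}\subseteq H\times\mathcal{U}$, where $\mathcal{U}$ is the set of orthogonal $n\times n$ matrices. For $(h,U)\in\mathcal{D}$,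 $\mu\in\mathbb{R}^n$, $\sigma>0$ and a positive definite $\Sigma$ let $Q_{\mu,\sigma^2\Sigma,h,U}$ be the distribution of $\mu+\sigma\Sigma^{1/2}U\mathbf{z}$, where $\mathbf{z}$ has density $h$ and $\Sigma^{1/2}$ is the symmetric nonnegative definite square root of $\Sigma$. **Theorem.** Suppose that (W) and (RX) hold. If $$\operatorname{span}\big(E_{n,\rho(\gamma,\mathfrak{M}_0^{lin})}(\gamma)\big)\not\subseteq\mathsf{B}\quad\text{for every }\gamma\in[0,\pi],\tag{1}$$ then for every $0<\alpha<1$ there exists a real number $C'(\alpha)$ such that $$\sup_{(h,U)\in\mathcal{D}}\ \sup_{\mu_0\in\mathfrak{M}_0}\ \sup_{0<\sigma^2<\infty}\ \sup_{f\in\mathfrak{F}_{\mathrm{all}}}Q_{\mu_0,\sigma^2\Sigma(f),h,U}\big(T_w\ge C'(\alpha)\big)\le\alpha .$$ Moreover, if $\mathsf{B}=\operatorname{span}(X)$, then condition (1) is equivalent to $$\operatorname{rank}\big(X,E_{n,\rho(\gamma,\mathfrak{M}_0^{lin})}(\gamma)\big)>k\quad\text{for every }\gamma\in[0,\pi].$$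 -/

import Mathlib

namespace HAR

open MeasureTheory Matrix
open scoped ENNReal

noncomputable section

/-! Vectors of `ℝⁿ` are functions `Fin n → ℝ`; no norm on them is used below, and `volume` is
Lebesgue measure. The index `i : Fin n` stands for the `(i + 1)`-th coordinate. -/

/-! ### The linear model and the hypothesis -/

/-- The span of the columns of a matrix. -/
def colSpan {n m : ℕ} (A : Matrix (Fin n) (Fin m) ℝ) : Submodule ℝ (Fin n → ℝ) :=
  Submodule.span ℝ (Set.range A.col)

/-- The affine space of mean vectors `X β` with `R β = r`. -/
def nullMeans {n k q : ℕ} (X : Matrix (Fin n) (Fin k) ℝ) (R : Matrix (Fin q) (Fin k) ℝ)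
    (r : Fin q → ℝ) : Set (Fin n → ℝ) :=
  {μ | ∃ β : Fin k → ℝ, μ = X *ᵥ β ∧ R *ᵥ β = r}

/-- The linear space parallel to the affine space `nullMeans X R r`
(`vectorSpan` is Mathlib's direction of a set in an affine space). -/
def nullMeansLin {n k q : ℕ} (X : Matrix (Fin n) (Fin k) ℝ) (R : Matrix (Fin q) (Fin k) ℝ)
    (r : Fin q → ℝ) : Submodule ℝ (Fin n → ℝ) :=
  vectorSpan ℝ (nullMeans X R r)

/-- The ordinary least squares estimator. -/
def olsBeta {n k : ℕ} (X : Matrix (Fin n) (Fin k) ℝ) (y : Fin n → ℝ) : Fin k → ℝ :=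
  ((Xᵀ * X)⁻¹ * Xᵀ) *ᵥ y

/-- The ordinary least squares residual vector. -/
def olsResid {n k : ℕ} (X : Matrix (Fin n) (Fin k) ℝ) (y : Fin n → ℝ) : Fin n → ℝ :=
  y - X *ᵥ olsBeta X y

/-! ### The autocorrelation robust test statistic -/

/-- The vector `v̂_t(y) = û_t(y) x_t'`, where `x_t` is the `t`-th row of `X`. -/
def vHat {n k : ℕ} (X : Matrix (Fin n) (Fin k) ℝ) (y : Fin n → ℝ) (t : Fin n) : Fin k → ℝ :=
  olsResid X y t • X.row t

/-- The empirical autocovariance `n⁻¹ ∑_{t = j+1}^n v̂_t v̂_{t-j}'` at a lag `j ≥ 0`;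
the sum is over the pairs `(t, s)` of time points with `t = s + j`. -/
def gammaHatNat {n k : ℕ} (X : Matrix (Fin n) (Fin k) ℝ) (y : Fin n → ℝ) (j : ℕ) :
    Matrix (Fin k) (Fin k) ℝ :=
  (n : ℝ)⁻¹ • ∑ t : Fin n, ∑ s : Fin n,
    if (t : ℕ) = (s : ℕ) + j then vecMulVec (vHat X y t) (vHat X y s) else 0

/-- The empirical autocovariance at an arbitrary lag, with `Γ̂_j = Γ̂_{-j}'` for `j < 0`. -/
def gammaHat {n k : ℕ} (X : Matrix (Fin n) (Fin k) ℝ) (y : Fin n → ℝ) (j : ℤ) :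
    Matrix (Fin k) (Fin k) ℝ :=
  if 0 ≤ j then gammaHatNat X y j.toNat else (gammaHatNat X y (-j).toNat)ᵀ

/-- The long-run variance estimator `Ψ̂_w(y) = ∑_{j = -(n-1)}^{n-1} w(j) Γ̂_j(y)`. -/
def psiHat {n k : ℕ} (w : ℤ → ℝ) (X : Matrix (Fin n) (Fin k) ℝ) (y : Fin n → ℝ) :
    Matrix (Fin k) (Fin k) ℝ :=
  ∑ j ∈ Finset.Icc (-((n : ℤ) - 1)) ((n : ℤ) - 1), w j • gammaHat X y j

/-- `Ω̂_w(y) = n R (X'X)⁻¹ Ψ̂_w(y) (X'X)⁻¹ R'`. -/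
def omegaHat {n k q : ℕ} (w : ℤ → ℝ) (X : Matrix (Fin n) (Fin k) ℝ)
    (R : Matrix (Fin q) (Fin k) ℝ) (y : Fin n → ℝ) : Matrix (Fin q) (Fin q) ℝ :=
  (n : ℝ) • (R * (Xᵀ * X)⁻¹ * psiHat w X y * (Xᵀ * X)⁻¹ * Rᵀ)

open Classical in
/-- The test statistic `T_w`, set to zero where `Ω̂_w` is singular. -/
def testStat {n k q : ℕ} (w : ℤ → ℝ) (X : Matrix (Fin n) (Fin k) ℝ)
    (R : Matrix (Fin q) (Fin k) ℝ) (r : Fin q → ℝ) (y : Fin n → ℝ) : ℝ :=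
  if (omegaHat w X R y).det ≠ 0 then
    (R *ᵥ olsBeta X y - r) ⬝ᵥ ((omegaHat w X R y)⁻¹ *ᵥ (R *ᵥ olsBeta X y - r))
  else 0

/-- The assumption on the weights `w(j, n)`, `|j| ≤ n - 1`. -/
structure WeightAssumption (n : ℕ) (w : ℤ → ℝ) : Prop where
  zero : w 0 = 1
  symm : ∀ j : ℤ, |j| ≤ (n : ℤ) - 1 → w (-j) = w j
  posDef : (Matrix.of fun i j : Fin n => w ((i : ℤ) - (j : ℤ))).PosDef

open Classical in
/-- `rank (R (X'X)⁻¹ X'(¬(i₁,…,i_s))) = q`, where `i₁, …, i_s` are the indices of the standard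
basis vectors that lie in `span(X)` and `X'(¬(i₁,…,i_s))` is `X'` without the columns
having these indices. -/
def DesignAssumption {n k q : ℕ} (X : Matrix (Fin n) (Fin k) ℝ)
    (R : Matrix (Fin q) (Fin k) ℝ) : Prop :=
  (R * (Xᵀ * X)⁻¹ *
    Xᵀ.submatrix id
      (Subtype.val : {i : Fin n // (Pi.single i 1 : Fin n → ℝ) ∉ colSpan X} → Fin n)).rank = q

/-- The matrix `B(y) = R (X'X)⁻¹ X' diag(û₁(y), …, ûₙ(y))`. -/
def bMatrix {n k q : ℕ} (X : Matrix (Fin n) (Fin k) ℝ) (R : Matrix (Fin q) (Fin k) ℝ)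
    (y : Fin n → ℝ) : Matrix (Fin q) (Fin n) ℝ :=
  R * (Xᵀ * X)⁻¹ * Xᵀ * Matrix.diagonal (olsResid X y)

/-- The exceptional set `𝖡 = {y : rank B(y) < q}`. -/
def bSet {n k q : ℕ} (X : Matrix (Fin n) (Fin k) ℝ) (R : Matrix (Fin q) (Fin k) ℝ) :
    Set (Fin n → ℝ) :=
  {y | (bMatrix X R y).rank < q}

/-! ### The non-inclusion condition -/

/-- The `n × 2` matrix `E_{n,s}(ω)` with `j`-th row `(j^s cos(jω), j^s sin(jω))`, `1 ≤ j ≤ n`. -/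
def eMatrix (n s : ℕ) (ω : ℝ) : Matrix (Fin n) (Fin 2) ℝ :=
  Matrix.of fun i =>
    ![((i : ℝ) + 1) ^ s * Real.cos (((i : ℝ) + 1) * ω),
      ((i : ℝ) + 1) ^ s * Real.sin (((i : ℝ) + 1) * ω)]

/-- `ρ(ω, L)`, the least `s ≥ 0` with `span(E_{n,s}(ω)) ⊄ L`. -/
def rho {n : ℕ} (ω : ℝ) (L : Submodule ℝ (Fin n → ℝ)) : ℕ :=
  sInf {s : ℕ | ¬ colSpan (eMatrix n s ω) ≤ L}

/-- `span(E_{n,ρ(γ, 𝔐₀^lin)}(γ)) ⊄ 𝖡` for every `γ ∈ [0, π]`. -/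
def NonInclusion {n k q : ℕ} (X : Matrix (Fin n) (Fin k) ℝ) (R : Matrix (Fin q) (Fin k) ℝ)
    (r : Fin q → ℝ) : Prop :=
  ∀ γ ∈ Set.Icc (0 : ℝ) Real.pi,
    ¬ ((colSpan (eMatrix n (rho γ (nullMeansLin X R r)) γ) : Set (Fin n → ℝ)) ⊆ bSet X R)

/-- `rank(X, E_{n,ρ(γ, 𝔐₀^lin)}(γ)) > k` for every `γ ∈ [0, π]`. -/
def RankCondition {n k q : ℕ} (X : Matrix (Fin n) (Fin k) ℝ) (R : Matrix (Fin q) (Fin k) ℝ)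
    (r : Fin q → ℝ) : Prop :=
  ∀ γ ∈ Set.Icc (0 : ℝ) Real.pi,
    k < (Matrix.fromCols X (eMatrix n (rho γ (nullMeansLin X R r)) γ)).rank

/-! ### Stationary covariance matrices -/

/-- `f` is a normalized spectral density (of a real weakly stationary process) on `[-π, π]`. -/
structure IsNormalizedSpectralDensity (f : ℝ → ℝ) : Prop where
  nonneg : ∀ ω ∈ Set.Icc (-Real.pi) Real.pi, 0 ≤ f ω
  even : ∀ ω ∈ Set.Icc (-Real.pi) Real.pi, f (-ω) = f ω
  integrable : IntegrableOn f (Set.Icc (-Real.pi) Real.pi)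
  integral_eq_one : ∫ ω in (-Real.pi)..Real.pi, f ω = 1

/-- The set of all normalized spectral densities. -/
def allSpectralDensities : Set (ℝ → ℝ) := {f | IsNormalizedSpectralDensity f}

/-- The `n × n` matrix `Σ(f)` with entries `∫_{-π}^{π} e^{-ι(j-l)ω} f(ω) dω`. The integrals are
real because `f` is even (`coe_specCov` below), and the real part is taken to get a real matrix. -/
def specCov (n : ℕ) (f : ℝ → ℝ) : Matrix (Fin n) (Fin n) ℝ :=
  Matrix.of fun j l =>
    (∫ ω in (-Real.pi)..Real.pi,
      Complex.exp (-Complex.I * (((j : ℝ) - (l : ℝ) : ℝ) : ℂ) * (ω : ℂ)) * (f ω : ℂ)).re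

theorem coe_specCov {n : ℕ} {f : ℝ → ℝ} (hf : IsNormalizedSpectralDensity f) (j l : Fin n) :
    ((specCov n f j l : ℝ) : ℂ) =
      ∫ ω in (-Real.pi)..Real.pi,
        Complex.exp (-Complex.I * (((j : ℝ) - (l : ℝ) : ℝ) : ℂ) * (ω : ℂ)) * (f ω : ℂ) := by
  set g : ℝ → ℂ := fun ω =>
    Complex.exp (-Complex.I * (((j : ℝ) - (l : ℝ) : ℝ) : ℂ) * (ω : ℂ)) * (f ω : ℂ) with hg
  have hpi : -Real.pi ≤ Real.pi := by linarith [Real.pi_pos]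
  have hconj : (starRingEnd ℂ) (∫ ω in (-Real.pi)..Real.pi, g ω)
      = ∫ ω in (-Real.pi)..Real.pi, g ω := by
    have h1 : (starRingEnd ℂ) (∫ ω in (-Real.pi)..Real.pi, g ω)
        = ∫ ω in (-Real.pi)..Real.pi, (starRingEnd ℂ) (g ω) := by
      rw [intervalIntegral.integral_of_le hpi, intervalIntegral.integral_of_le hpi]
      exact integral_conj.symm
    have h2 : ∫ ω in (-Real.pi)..Real.pi, (starRingEnd ℂ) (g ω)
        = ∫ ω in (-Real.pi)..Real.pi, g (-ω) := by
      apply intervalIntegral.integral_congr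
      intro ω hω
      rw [Set.uIcc_of_le hpi] at hω
      simp only [hg, map_mul, ← Complex.exp_conj, Complex.conj_ofReal, map_neg, Complex.conj_I,
        hf.even ω hω, Complex.ofReal_neg]
      congr 2
      ring
    rw [h1, h2, intervalIntegral.integral_comp_neg (fun ω => g ω), neg_neg]
  exact Complex.conj_eq_iff_re.mp hconj

/-! ### Non-Gaussian errors -/

/-- The distribution on `ℝⁿ` with Lebesgue density `h`. -/
def densityLaw {n : ℕ} (h : (Fin n → ℝ) → ℝ) : Measure (Fin n → ℝ) :=
  volume.withDensity fun z => ENNReal.ofReal (h z)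

/-- `h` is a probability density on `ℝⁿ` under which the random vector `z` has mean zero and
unit covariance matrix. -/
structure IsStandardizedDensity {n : ℕ} (h : (Fin n → ℝ) → ℝ) : Prop where
  measurable : Measurable h
  nonneg : ∀ z, 0 ≤ h z
  isProbability : IsProbabilityMeasure (densityLaw h)
  memLp : ∀ i, MemLp (fun z : Fin n → ℝ => z i) 2 (densityLaw h)
  mean : ∀ i, ∫ z, z i ∂(densityLaw h) = 0
  cov : ∀ i j, ProbabilityTheory.covariance (fun z : Fin n → ℝ => z i) (fun z => z j)
    (densityLaw h) = (1 : Matrix (Fin n) (Fin n) ℝ) i j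

/-- `H` has a Lebesgue-integrable envelope (which may take the value `∞`). -/
def HasIntegrableEnvelope {n : ℕ} (H : Set ((Fin n → ℝ) → ℝ)) : Prop :=
  ∃ hstar : (Fin n → ℝ) → ℝ≥0∞, Measurable hstar ∧ ∫⁻ z, hstar z ≠ ∞ ∧
    ∀ h ∈ H, ∀ᵐ z, ENNReal.ofReal (h z) ≤ hstar z

open scoped MatrixOrder in
/-- The symmetric nonnegative definite square root of a symmetric nonnegative definite matrix. -/
def matSqrt {n : ℕ} (S : Matrix (Fin n) (Fin n) ℝ) : Matrix (Fin n) (Fin n) ℝ :=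
  CFC.sqrt S

/-- `Q_{μ, σ²S, h, U}`: the distribution of `μ + σ S^{1/2} U z` where `z` has density `h`. -/
def lawQ {n : ℕ} (μ : Fin n → ℝ) (σ : ℝ) (S : Matrix (Fin n) (Fin n) ℝ)
    (h : (Fin n → ℝ) → ℝ) (U : Matrix (Fin n) (Fin n) ℝ) : Measure (Fin n → ℝ) :=
  (densityLaw h).map fun z => μ + σ • ((matSqrt S * U) *ᵥ z)

/-- The supremum of the rejection probabilities of a rejection region `W` over `(h, U) ∈ D`,
`μ₀ ∈ 𝔐₀`, `0 < σ < ∞` and all normalized spectral densities `f`. -/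
def sizeAll {n k q : ℕ} (X : Matrix (Fin n) (Fin k) ℝ) (R : Matrix (Fin q) (Fin k) ℝ)
    (r : Fin q → ℝ) (D : Set (((Fin n → ℝ) → ℝ) × Matrix (Fin n) (Fin n) ℝ))
    (W : Set (Fin n → ℝ)) : ℝ≥0∞ :=
  ⨆ d ∈ D, ⨆ μ₀ ∈ nullMeans X R r, ⨆ σ ∈ Set.Ioi (0 : ℝ), ⨆ f ∈ allSpectralDensities,
    lawQ μ₀ σ (specCov n f) d.1 d.2 W

end

end HAR

namespace HAR

open MeasureTheory Matrix Filter Topology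
open scoped ENNReal

noncomputable section

section

attribute [local instance] Matrix.normedAddCommGroup Matrix.normedSpace

/-! ### Compactness of convex hulls -/

/-! Let `L` be the linear space parallel to the null means and `P` a matrix with kernel `L` and `y -
P y ∈ L`. The statistic is unchanged by scaling about a null mean and by shifts along `L`, so under
the null it equals the statistic with `r = 0` evaluated at `P Σ(f)^{1/2} U z`
(`testStat_add_smul_eq`). Only the matrix `P Σ(f)^{1/2} U`, up to a positive factor, matters.

These matrices, once normalized, lie in a compact set. Indeed `P Σ(f) P'` is the `f`-integral of `P
E E' P'` with `E = E_{n,0}(|ω|)`. Divided by its trace, this Gram matrix extends continuously across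
the zeros of `P E_{n,0}`: the derivatives of `E_{n,0}` are the `E_{n,s}` up to a rotation, so the
limit at `γ` is the normalized Gram matrix of `P E_{n,ρ}(γ)` (`continuous_leadGram`). Hence `P Σ(f)
P'` is a nonnegative multiple of an element of the compact convex hull of these limits
(`exists_mul_specCov_mul_transpose_eq_smul`).

If `A A'` lies in this hull, it dominates a positive multiple of one generator, so the span of `A`
contains that of `P E_{n,ρ}(γ)` for some `γ`. Condition (1) then makes `det Ω̂` nonzero at some `A
z₀`, hence at `A z` for almost every `z`, because the determinant is polynomial along lines. The
statistic is thus continuous at `A z` almost everywhere, and compactness together with dominated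
convergence under the envelope yields one critical value for all `A`
(`exists_forall_setLIntegral_le`). -/

theorem isCompact_convexHull_of_finiteDimensional {E : Type*} [NormedAddCommGroup E]
    [NormedSpace ℝ E] [FiniteDimensional ℝ E] {K : Set E} (hK : IsCompact K) :
    IsCompact (convexHull ℝ K) := by
  -- Carathéodory: combinations of at most `dim E + 1` points suffice, so the hull is a finite union
  -- of continuous images of simplex times `K^m`.
  have hunion : convexHull ℝ K = ⋃ m ∈ Set.Iic (Module.finrank ℝ E + 1),
      (fun p : (Fin m → ℝ) × (Fin m → E) => ∑ i, p.1 i • p.2 i) ''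
        (stdSimplex ℝ (Fin m) ×ˢ Set.univ.pi fun _ => K) := by
    apply Set.Subset.antisymm
    · intro x hx
      obtain ⟨ι, _, z, w, hz, hind, hpos, hsum, rfl⟩ := eq_pos_convex_span_of_mem_convexHull hx
      have hcard := hind.card_le_finrank_succ
      have hle : Module.finrank ℝ (vectorSpan ℝ (Set.range z)) ≤ Module.finrank ℝ E :=
        Submodule.finrank_le _
      let e := Fintype.equivFin ι
      simp only [Set.mem_iUnion]
      refine ⟨Fintype.card ι, by simp only [Set.mem_Iic]; omega,
        (fun i => w (e.symm i), fun i => z (e.symm i)), ⟨⟨fun i => (hpos _).le, ?_⟩, ?_⟩, ?_⟩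
      · rw [← hsum]; exact Equiv.sum_comp e.symm w
      · intro i _; exact hz ⟨_, rfl⟩
      · exact Equiv.sum_comp e.symm fun i => w i • z i
    · simp only [Set.iUnion_subset_iff]
      rintro m - _ ⟨⟨w, z⟩, ⟨hw, hz⟩, rfl⟩
      exact (convex_convexHull ℝ K).sum_mem (fun i _ => hw.1 i) hw.2
        fun i _ => subset_convexHull ℝ K (hz i (Set.mem_univ i))
  rw [hunion]
  refine (Set.finite_Iic _).isCompact_biUnion fun m _ => IsCompact.image ?_ (by fun_prop)
  exact (isCompact_stdSimplex ℝ (Fin m)).prod (isCompact_univ_pi fun _ => hK)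

/-! ### Leading terms at a zero -/

/-- Since `f s` is the `s`-th derivative of `f 0`, the Taylor polynomial of order `p` at `γ` reduces
to its top term. -/
theorem tendsto_inv_pow_smul_of_deriv_eq_zero {F : Type*} [NormedAddCommGroup F]
    [NormedSpace ℝ F] {f : ℕ → ℝ → F} (hf : ∀ s x, HasDerivAt (f s) (f (s + 1) x) x)
    {p : ℕ} {γ : ℝ} (hz : ∀ s < p, f s γ = 0) :
    Tendsto (fun x => ((x - γ) ^ p)⁻¹ • f 0 x) (𝓝[≠] γ) (𝓝 ((p.factorial : ℝ)⁻¹ • f p γ)) := by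
  have hit : ∀ s, iteratedDeriv s (f 0) = f s := by
    intro s
    induction s with
    | zero => exact iteratedDeriv_zero
    | succ s ih => rw [iteratedDeriv_succ, ih]; exact funext fun x => (hf s x).deriv
  have hcd : ContDiff ℝ p (f 0) := by
    refine contDiff_of_differentiable_iteratedDeriv fun m _ => ?_
    rw [hit]
    exact fun x => (hf m x).differentiableAt
  have ht := taylor_tendsto (x₀ := γ) (n := p) convex_univ (Set.mem_univ γ) hcd.contDiffOn
  have hpoly : ∀ x, taylorWithinEval (f 0) p Set.univ γ x
      = ((p.factorial : ℝ)⁻¹ * (x - γ) ^ p) • f p γ := by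
    intro x
    rw [taylor_within_apply, Finset.sum_range_succ, Finset.sum_eq_zero, zero_add,
      iteratedDerivWithin_univ, hit]
    intro s hs
    rw [iteratedDerivWithin_univ, hit, hz s (Finset.mem_range.mp hs), smul_zero]
  rw [nhdsWithin_univ] at ht
  have ht' := (ht.mono_left (nhdsWithin_le_nhds (s := {γ}ᶜ))).add_const
    ((p.factorial : ℝ)⁻¹ • f p γ)
  rw [zero_add] at ht'
  refine ht'.congr' ?_
  filter_upwards [self_mem_nhdsWithin] with x hx
  have hne : (x - γ) ^ p ≠ 0 := pow_ne_zero _ (sub_ne_zero.mpr hx)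
  rw [hpoly, smul_sub, smul_smul, mul_comm (p.factorial : ℝ)⁻¹, inv_mul_cancel_left₀ hne,
    sub_add_cancel]

/-! ### Normalized Gram matrices -/

/-- `V V'` divided by its trace. -/
def normGram {n m : ℕ} (V : Matrix (Fin n) (Fin m) ℝ) : Matrix (Fin n) (Fin n) ℝ :=
  (V * Vᵀ).trace⁻¹ • (V * Vᵀ)

theorem trace_mul_transpose_nonneg {n m : ℕ} (V : Matrix (Fin n) (Fin m) ℝ) :
    0 ≤ (V * Vᵀ).trace := by
  simp only [trace, diag_apply, mul_apply, transpose_apply]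
  exact Finset.sum_nonneg fun i _ => Finset.sum_nonneg fun j _ => mul_self_nonneg _

theorem sq_le_trace_mul_transpose {n m : ℕ} (V : Matrix (Fin n) (Fin m) ℝ) (i : Fin n)
    (j : Fin m) : V i j ^ 2 ≤ (V * Vᵀ).trace := by
  simp only [trace, diag_apply, mul_apply, transpose_apply]
  calc V i j ^ 2 = V i j * V i j := sq _
    _ ≤ ∑ b, V i b * V i b :=
      Finset.single_le_sum (f := fun b => V i b * V i b) (fun b _ => mul_self_nonneg _)
        (Finset.mem_univ j)
    _ ≤ _ := Finset.single_le_sum (f := fun a => ∑ b, V a b * V a b)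
        (fun a _ => Finset.sum_nonneg fun b _ => mul_self_nonneg _) (Finset.mem_univ i)

theorem trace_mul_transpose_eq_zero_iff {n m : ℕ} (V : Matrix (Fin n) (Fin m) ℝ) :
    (V * Vᵀ).trace = 0 ↔ V = 0 := by
  refine ⟨fun h => ?_, fun h => by simp [h]⟩
  ext i j
  have := sq_le_trace_mul_transpose V i j
  rw [h] at this
  exact pow_eq_zero_iff two_ne_zero |>.mp (le_antisymm this (sq_nonneg _))

theorem trace_normGram {n m : ℕ} {V : Matrix (Fin n) (Fin m) ℝ} (hV : V ≠ 0) :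
    (normGram V).trace = 1 := by
  rw [normGram, trace_smul, smul_eq_mul,
    inv_mul_cancel₀ (mt (trace_mul_transpose_eq_zero_iff V).mp hV)]

theorem trace_smul_normGram {n m : ℕ} (V : Matrix (Fin n) (Fin m) ℝ) :
    (V * Vᵀ).trace • normGram V = V * Vᵀ := by
  by_cases hV : V = 0
  · simp [hV]
  · rw [normGram, smul_smul, mul_inv_cancel₀ (mt (trace_mul_transpose_eq_zero_iff V).mp hV),
      one_smul]

theorem normGram_smul {n m : ℕ} {c : ℝ} (hc : c ≠ 0) (V : Matrix (Fin n) (Fin m) ℝ) :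
    normGram (c • V) = normGram V := by
  simp only [normGram, transpose_smul, Matrix.smul_mul, Matrix.mul_smul, trace_smul, smul_smul,
    smul_eq_mul]
  congr 1
  field_simp

theorem normGram_mul_of_mul_transpose_eq_one {n m : ℕ} (V : Matrix (Fin n) (Fin m) ℝ)
    {Q : Matrix (Fin m) (Fin m) ℝ} (hQ : Q * Qᵀ = 1) : normGram (V * Q) = normGram V := by
  have : V * Q * (V * Q)ᵀ = V * Vᵀ := by
    rw [transpose_mul, Matrix.mul_assoc, ← Matrix.mul_assoc Q, hQ, Matrix.one_mul]
  simp only [normGram, this]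

theorem continuousAt_normGram {n m : ℕ} {V : Matrix (Fin n) (Fin m) ℝ} (hV : V ≠ 0) :
    ContinuousAt (normGram (n := n) (m := m)) V := by
  have hc : Continuous fun V : Matrix (Fin n) (Fin m) ℝ => V * Vᵀ := by fun_prop
  exact (hc.matrix_trace.continuousAt.inv₀ (mt (trace_mul_transpose_eq_zero_iff V).mp hV)).smul
    hc.continuousAt

/-! ### The matrices `E_{n,s}(ω)` -/

/-- The rotation with `E_{n,s}' = E_{n,s+1} J`. -/
def rotJ : Matrix (Fin 2) (Fin 2) ℝ := !![0, 1; -1, 0]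

theorem rotJ_mul_transpose : rotJ * rotJᵀ = 1 := by
  ext i j
  fin_cases i <;> fin_cases j <;> simp [rotJ, mul_apply]

theorem rotJ_pow_mul_transpose (s : ℕ) : rotJ ^ s * (rotJ ^ s)ᵀ = 1 := by
  induction s with
  | zero => simp
  | succ s ih =>
    rw [pow_succ, transpose_mul, Matrix.mul_assoc, ← Matrix.mul_assoc rotJ, rotJ_mul_transpose,
      Matrix.one_mul, ih]

theorem hasDerivAt_eMatrix (n s : ℕ) (ω : ℝ) :
    HasDerivAt (fun x => eMatrix n s x) (eMatrix n (s + 1) ω * rotJ) ω := by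
  refine hasDerivAt_pi.mpr fun i => hasDerivAt_pi.mpr fun j => ?_
  have hlin : HasDerivAt (fun x : ℝ => ((i : ℝ) + 1) * x) ((i : ℝ) + 1) ω := by
    simpa using (hasDerivAt_id ω).const_mul ((i : ℝ) + 1)
  fin_cases j
  · have := hlin.cos.const_mul (((i : ℝ) + 1) ^ s)
    change HasDerivAt (fun x => eMatrix n s x i 0) ((eMatrix n (s + 1) ω * rotJ) i 0) ω
    refine this.congr_deriv ?_
    simp [eMatrix, rotJ, mul_apply]
    ring
  · have := hlin.sin.const_mul (((i : ℝ) + 1) ^ s)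
    change HasDerivAt (fun x => eMatrix n s x i 1) ((eMatrix n (s + 1) ω * rotJ) i 1) ω
    refine this.congr_deriv ?_
    simp [eMatrix, rotJ, mul_apply]
    ring

/-- Puts the successive derivatives of `P E_{n,0}` in the form the Taylor limit needs; the
orthogonal factor `J^s` drops out of Gram matrices. -/
theorem hasDerivAt_mul_eMatrix_mul_rotJ {n m : ℕ} (P : Matrix (Fin m) (Fin n) ℝ) (s : ℕ)
    (ω : ℝ) : HasDerivAt (fun x => P * eMatrix n s x * rotJ ^ s)
      (P * eMatrix n (s + 1) ω * rotJ ^ (s + 1)) ω := by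
  let ℓ : Matrix (Fin n) (Fin 2) ℝ →ₗ[ℝ] Matrix (Fin m) (Fin 2) ℝ :=
    { toFun := fun A => P * A * rotJ ^ s
      map_add' := fun A B => by rw [Matrix.mul_add, Matrix.add_mul]
      map_smul' := fun c A => by simp }
  have h := (LinearMap.toContinuousLinearMap ℓ).hasFDerivAt.comp_hasDerivAt ω
    (hasDerivAt_eMatrix n s ω)
  refine h.congr_deriv ?_
  change P * (eMatrix n (s + 1) ω * rotJ) * rotJ ^ s = _
  rw [pow_succ']
  simp only [Matrix.mul_assoc]

theorem continuous_eMatrix (n s : ℕ) : Continuous fun ω => eMatrix n s ω :=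
  continuous_iff_continuousAt.mpr fun ω => (hasDerivAt_eMatrix n s ω).continuousAt

/-! ### The order `ρ(ω, L)` -/

theorem colSpan_eq_range {n m : ℕ} (A : Matrix (Fin n) (Fin m) ℝ) :
    colSpan A = LinearMap.range A.mulVecLin := (range_mulVecLin A).symm

theorem mem_colSpan {n m : ℕ} {A : Matrix (Fin n) (Fin m) ℝ} {v : Fin n → ℝ} :
    v ∈ colSpan A ↔ ∃ b, A *ᵥ b = v := by
  rw [colSpan_eq_range]; rfl

theorem colSpan_le_ker_iff {n m l : ℕ} {A : Matrix (Fin n) (Fin m) ℝ}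
    {P : Matrix (Fin l) (Fin n) ℝ} : colSpan A ≤ LinearMap.ker P.mulVecLin ↔ P * A = 0 := by
  rw [colSpan_eq_range, LinearMap.range_le_ker_iff, ← mulVecLin_mul, ← mulVecLin_zero]
  constructor
  · intro h
    exact ext_of_mulVec_single fun i => by
      simpa only [mulVecLin_apply, zero_mulVec] using LinearMap.congr_fun h (Pi.single i 1)
  · intro h; rw [h]

/-- A functional `φ` killing `L` would kill every vector `(j^s c_j)_j` with `c_j = cos(jω)` or
`sin(jω)`. The nodes `j` are distinct, so Vandermonde gives `φ(e_j) c_j = 0`; cosine and sine never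
vanish together, hence `φ = 0`. Thus `ρ` is an infimum over a nonempty set. -/
theorem exists_not_colSpan_eMatrix_le {n : ℕ} (ω : ℝ) {L : Submodule ℝ (Fin n → ℝ)}
    (hL : L ≠ ⊤) : ∃ s, ¬ colSpan (eMatrix n s ω) ≤ L := by
  by_contra! hle
  obtain ⟨v, hv⟩ : ∃ v, v ∉ L := by
    by_contra! h
    exact hL (eq_top_iff.mpr fun v _ => h v)
  obtain ⟨φ, hφv, hφL⟩ := Submodule.exists_le_ker_of_notMem hv
  apply hφv
  have hinj : Function.Injective fun i : Fin n => (i : ℝ) + 1 := fun i j h =>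
    Fin.ext (by simpa using h)
  have key : ∀ c : Fin n → ℝ, (∀ s, (fun i : Fin n => ((i : ℝ) + 1) ^ s * c i) ∈ L) →
      ∀ i, φ (Pi.single i 1) * c i = 0 := by
    intro c hc
    refine congrFun (f := fun i => φ (Pi.single i 1) * c i) (g := 0) ?_
    refine eq_zero_of_vecMul_eq_zero (det_vandermonde_ne_zero_iff.mpr hinj) ?_
    ext s
    have h0 : φ (fun i : Fin n => ((i : ℝ) + 1) ^ (s : ℕ) * c i) = 0 := hφL (hc s)
    rw [LinearMap.pi_apply_eq_sum_univ φ] at h0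
    simp only [vecMul, dotProduct, vandermonde_apply, Pi.zero_apply]
    rw [← h0]
    refine Finset.sum_congr rfl fun i _ => ?_
    have : (fun j => if i = j then (1 : ℝ) else 0) = Pi.single i 1 := by
      ext j; simp [Pi.single_apply, eq_comm]
    rw [this, smul_eq_mul]
    ring
  have hcos := key (fun i => Real.cos (((i : ℝ) + 1) * ω)) fun s => hle s <|
    mem_colSpan.mpr ⟨![1, 0], by ext i; simp [eMatrix, mulVec, dotProduct]⟩
  have hsin := key (fun i => Real.sin (((i : ℝ) + 1) * ω)) fun s => hle s <|
    mem_colSpan.mpr ⟨![0, 1], by ext i; simp [eMatrix, mulVec, dotProduct]⟩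
  have hzero : ∀ i, φ (Pi.single i 1) = 0 := by
    intro i
    rcases mul_eq_zero.mp (hcos i) with h | h
    · exact h
    · rcases mul_eq_zero.mp (hsin i) with h' | h'
      · exact h'
      · have := Real.sin_sq_add_cos_sq (((i : ℝ) + 1) * ω)
        rw [h, h'] at this
        norm_num at this
  rw [LinearMap.pi_apply_eq_sum_univ φ]
  refine Finset.sum_eq_zero fun i _ => ?_
  have : (fun j => if i = j then (1 : ℝ) else 0) = Pi.single i 1 := by
    ext j; simp [Pi.single_apply, eq_comm]
  rw [this, hzero, smul_zero]

theorem not_colSpan_eMatrix_rho_le {n : ℕ} (ω : ℝ) {L : Submodule ℝ (Fin n → ℝ)}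
    (hL : L ≠ ⊤) : ¬ colSpan (eMatrix n (rho ω L) ω) ≤ L :=
  Nat.sInf_mem (exists_not_colSpan_eMatrix_le ω hL)

theorem colSpan_eMatrix_le_of_lt_rho {n s : ℕ} {ω : ℝ} {L : Submodule ℝ (Fin n → ℝ)}
    (hs : s < rho ω L) : colSpan (eMatrix n s ω) ≤ L :=
  not_not.mp (Nat.notMem_of_lt_sInf hs)

theorem rho_eq_zero {n : ℕ} {ω : ℝ} {L : Submodule ℝ (Fin n → ℝ)}
    (h : ¬ colSpan (eMatrix n 0 ω) ≤ L) : rho ω L = 0 :=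
  Nat.sInf_eq_zero.mpr (Or.inl h)

/-- The normalized Gram matrix of the leading coefficient of `P E_{n,0}` at `ω`. -/
def leadGram {n : ℕ} (P : Matrix (Fin n) (Fin n) ℝ) (ω : ℝ) : Matrix (Fin n) (Fin n) ℝ :=
  normGram (P * eMatrix n (rho ω (LinearMap.ker P.mulVecLin)) ω)

theorem mul_eMatrix_rho_ne_zero {n : ℕ} {P : Matrix (Fin n) (Fin n) ℝ}
    (hP : LinearMap.ker P.mulVecLin ≠ ⊤) (ω : ℝ) :
    P * eMatrix n (rho ω (LinearMap.ker P.mulVecLin)) ω ≠ 0 := fun h =>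
  not_colSpan_eMatrix_rho_le ω hP (colSpan_le_ker_iff.mpr h)

theorem leadGram_eq_of_ne_zero {n : ℕ} {P : Matrix (Fin n) (Fin n) ℝ} {ω : ℝ}
    (h : P * eMatrix n 0 ω ≠ 0) : leadGram P ω = normGram (P * eMatrix n 0 ω) := by
  rw [leadGram, rho_eq_zero (mt colSpan_le_ker_iff.mp h)]

/-- Valid also at the zeros of `P E_{n,0}`, where both sides vanish; this lets the trace be absorbed
into the spectral density. -/
theorem trace_smul_leadGram {n : ℕ} (P : Matrix (Fin n) (Fin n) ℝ) (ω : ℝ) :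
    (P * eMatrix n 0 ω * (P * eMatrix n 0 ω)ᵀ).trace • leadGram P ω
      = P * eMatrix n 0 ω * (P * eMatrix n 0 ω)ᵀ := by
  by_cases h : P * eMatrix n 0 ω = 0
  · simp [h]
  · rw [leadGram_eq_of_ne_zero h, trace_smul_normGram]

/-- Near `γ`, dividing `P E_{n,0}(x)` by `(x - γ)^ρ` gives a nonzero limit proportional to `P
E_{n,ρ}(γ) J^ρ`. Neither nonzero scalars nor right orthogonal factors affect `normGram`, which is
continuous away from zero. -/
theorem continuous_leadGram {n : ℕ} {P : Matrix (Fin n) (Fin n) ℝ}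
    (hP : LinearMap.ker P.mulVecLin ≠ ⊤) : Continuous (leadGram P) := by
  refine continuous_iff_continuousAt.mpr fun γ => ?_
  rw [continuousAt_iff_punctured_nhds]
  set p := rho γ (LinearMap.ker P.mulVecLin) with hp
  have hlim := tendsto_inv_pow_smul_of_deriv_eq_zero (hasDerivAt_mul_eMatrix_mul_rotJ P)
    (p := p) (γ := γ) fun s hs => by
      rw [colSpan_le_ker_iff.mp (colSpan_eMatrix_le_of_lt_rho hs), Matrix.zero_mul]
  have hfac : ((p.factorial : ℝ)⁻¹) ≠ 0 := inv_ne_zero (Nat.cast_ne_zero.mpr p.factorial_ne_zero)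
  have hne : ((p.factorial : ℝ)⁻¹) • (P * eMatrix n p γ * rotJ ^ p) ≠ 0 := by
    intro h
    rcases smul_eq_zero.mp h with h | h
    · exact hfac h
    · apply mul_eMatrix_rho_ne_zero hP γ
      have := congrArg (fun A => A * (rotJ ^ p)ᵀ) h
      simpa only [Matrix.mul_assoc, rotJ_pow_mul_transpose, Matrix.mul_one, Matrix.zero_mul]
        using this
  have hG := (continuousAt_normGram hne).tendsto.comp hlim
  rw [normGram_smul hfac, normGram_mul_of_mul_transpose_eq_one _ (rotJ_pow_mul_transpose p)] at hG
  refine hG.congr' ?_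
  filter_upwards [hlim.eventually_ne hne, self_mem_nhdsWithin] with x hx hxγ
  rw [pow_zero, Matrix.mul_one] at hx
  have hx0 : P * eMatrix n 0 x ≠ 0 := fun h => hx (by rw [h, smul_zero])
  simp only [Function.comp_apply, pow_zero, Matrix.mul_one]
  rw [normGram_smul (inv_ne_zero (pow_ne_zero _ (sub_ne_zero.mpr hxγ))), leadGram_eq_of_ne_zero hx0]

end

/-! ### The test statistic as a ratio of quadratic forms -/

/-- The matrix of weights `w(i - j)`. -/
def weightMatrix (n : ℕ) (w : ℤ → ℝ) : Matrix (Fin n) (Fin n) ℝ :=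
  Matrix.of fun i j : Fin n => w ((i : ℤ) - (j : ℤ))

theorem gammaHat_eq_sum {n k : ℕ} (X : Matrix (Fin n) (Fin k) ℝ) (y : Fin n → ℝ) (j : ℤ) :
    gammaHat X y j = (n : ℝ)⁻¹ • ∑ t : Fin n, ∑ s : Fin n,
      if (t : ℤ) - (s : ℤ) = j then vecMulVec (vHat X y t) (vHat X y s) else 0 := by
  unfold gammaHat gammaHatNat
  split_ifs with hj
  · congr 1
    refine Finset.sum_congr rfl fun t _ => Finset.sum_congr rfl fun s _ => ?_
    exact if_congr (by omega) rfl rfl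
  · rw [transpose_smul, transpose_sum, Finset.sum_congr rfl fun t _ => transpose_sum _ _,
      Finset.sum_comm]
    congr 1
    refine Finset.sum_congr rfl fun t _ => Finset.sum_congr rfl fun s _ => ?_
    rw [apply_ite transpose, transpose_vecMulVec, transpose_zero]
    exact if_congr (by omega) rfl rfl

/-- The lags in the sum exhaust all differences `t - s`, so each pair `(t, s)` occurs exactly once,
with weight `w(t - s)`. -/
theorem psiHat_eq {n k : ℕ} (w : ℤ → ℝ) (X : Matrix (Fin n) (Fin k) ℝ) (y : Fin n → ℝ) :
    psiHat w X y = (n : ℝ)⁻¹ • ((diagonal (olsResid X y) * X)ᵀ * weightMatrix n w *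
      (diagonal (olsResid X y) * X)) := by
  have h1 : psiHat w X y = (n : ℝ)⁻¹ • ∑ t : Fin n, ∑ s : Fin n,
      w ((t : ℤ) - (s : ℤ)) • vecMulVec (vHat X y t) (vHat X y s) := by
    simp only [psiHat, gammaHat_eq_sum, smul_comm _ (n : ℝ)⁻¹, ← Finset.smul_sum]
    congr 1
    simp only [Finset.smul_sum]
    rw [Finset.sum_comm]
    refine Finset.sum_congr rfl fun t _ => ?_
    rw [Finset.sum_comm]
    refine Finset.sum_congr rfl fun s _ => ?_
    simp only [smul_ite, smul_zero]
    rw [Finset.sum_ite_eq, if_pos]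
    rw [Finset.mem_Icc]
    omega
  rw [h1]
  congr 1
  ext a b
  rw [mul_apply]
  simp only [Matrix.sum_apply, Matrix.smul_apply, vecMulVec_apply, mul_apply (M := _ᵀ),
    transpose_apply, diagonal_mul, weightMatrix, of_apply, vHat, Pi.smul_apply, row_apply, smul_eq_mul,
    Finset.sum_mul]
  rw [Finset.sum_comm]
  refine Finset.sum_congr rfl fun s _ => Finset.sum_congr rfl fun t _ => ?_
  ring

theorem omegaHat_eq {n k q : ℕ} (hn : n ≠ 0) (w : ℤ → ℝ) (X : Matrix (Fin n) (Fin k) ℝ)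
    (R : Matrix (Fin q) (Fin k) ℝ) (y : Fin n → ℝ) :
    omegaHat w X R y = bMatrix X R y * weightMatrix n w * (bMatrix X R y)ᵀ := by
  have hsymm : ((Xᵀ * X)⁻¹)ᵀ = (Xᵀ * X)⁻¹ := by
    rw [transpose_nonsing_inv, transpose_mul, transpose_transpose]
  rw [omegaHat, psiHat_eq, bMatrix]
  simp only [Matrix.mul_smul, Matrix.smul_mul, smul_smul]
  rw [mul_inv_cancel₀ (Nat.cast_ne_zero.mpr hn), one_smul]
  simp only [transpose_mul, diagonal_transpose, transpose_transpose, hsymm, Matrix.mul_assoc]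

/-- With `0⁻¹ = 0` the adjugate formula also covers singular `Ω̂_w`; measurability and continuity
are read off from it. -/
theorem testStat_eq {n k q : ℕ} (w : ℤ → ℝ) (X : Matrix (Fin n) (Fin k) ℝ)
    (R : Matrix (Fin q) (Fin k) ℝ) (r : Fin q → ℝ) (y : Fin n → ℝ) :
    testStat w X R r y = (omegaHat w X R y).det⁻¹ *
      ((R *ᵥ olsBeta X y - r) ⬝ᵥ ((omegaHat w X R y).adjugate *ᵥ (R *ᵥ olsBeta X y - r))) := by
  unfold testStat
  split_ifs with h
  · rw [inv_def, Ring.inverse_eq_inv', smul_mulVec, dotProduct_smul, smul_eq_mul]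
  · rw [not_not.mp h, _root_.inv_zero, zero_mul]

/-! ### Equivariance -/

theorem isUnit_det_transpose_mul_self {n k : ℕ} {X : Matrix (Fin n) (Fin k) ℝ}
    (hX : X.rank = k) : IsUnit (Xᵀ * X).det := by
  rw [← isUnit_iff_isUnit_det, ← mulVec_injective_iff_isUnit, ← coe_mulVecLin]
  have hr : (Xᵀ * X).rank = k := by rw [rank_transpose_mul_self, hX]
  have := LinearMap.injective_iff_surjective (f := (Xᵀ * X).mulVecLin)
  rw [this, ← LinearMap.range_eq_top]
  apply Submodule.eq_top_of_finrank_eq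
  rw [← Matrix.rank, hr]; simp

theorem olsBeta_mulVec_add_smul {n k : ℕ} {X : Matrix (Fin n) (Fin k) ℝ} (hX : X.rank = k)
    (β : Fin k → ℝ) (c : ℝ) (y : Fin n → ℝ) :
    olsBeta X (X *ᵥ β + c • y) = β + c • olsBeta X y := by
  rw [olsBeta, mulVec_add, mulVec_mulVec, Matrix.mul_assoc,
    nonsing_inv_mul _ (isUnit_det_transpose_mul_self hX), one_mulVec, mulVec_smul, olsBeta]

theorem olsResid_mulVec_add_smul {n k : ℕ} {X : Matrix (Fin n) (Fin k) ℝ} (hX : X.rank = k)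
    (β : Fin k → ℝ) (c : ℝ) (y : Fin n → ℝ) :
    olsResid X (X *ᵥ β + c • y) = c • olsResid X y := by
  rw [olsResid, olsBeta_mulVec_add_smul hX, mulVec_add, mulVec_smul, olsResid, smul_sub]
  abel

theorem bMatrix_mulVec_add_smul {n k q : ℕ} {X : Matrix (Fin n) (Fin k) ℝ} (hX : X.rank = k)
    (R : Matrix (Fin q) (Fin k) ℝ) (β : Fin k → ℝ) (c : ℝ) (y : Fin n → ℝ) :
    bMatrix X R (X *ᵥ β + c • y) = c • bMatrix X R y := by
  rw [bMatrix, olsResid_mulVec_add_smul hX, diagonal_smul, Matrix.mul_smul, bMatrix]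

theorem omegaHat_mulVec_add_smul {n k q : ℕ} (hn : n ≠ 0) (w : ℤ → ℝ)
    {X : Matrix (Fin n) (Fin k) ℝ} (hX : X.rank = k) (R : Matrix (Fin q) (Fin k) ℝ)
    (β : Fin k → ℝ) (c : ℝ) (y : Fin n → ℝ) :
    omegaHat w X R (X *ᵥ β + c • y) = c ^ 2 • omegaHat w X R y := by
  simp only [omegaHat_eq hn, bMatrix_mulVec_add_smul hX, transpose_smul, Matrix.smul_mul,
    Matrix.mul_smul, smul_smul, sq]

theorem testStat_mulVec_add_smul {n k q : ℕ} (hn : n ≠ 0) (w : ℤ → ℝ)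
    {X : Matrix (Fin n) (Fin k) ℝ} (hX : X.rank = k) {R : Matrix (Fin q) (Fin k) ℝ}
    {r : Fin q → ℝ} {β : Fin k → ℝ} (hβ : R *ᵥ β = r) {c : ℝ} (hc : c ≠ 0) (y : Fin n → ℝ) :
    testStat w X R r (X *ᵥ β + c • y) = testStat w X R 0 y := by
  have hv : R *ᵥ olsBeta X (X *ᵥ β + c • y) - r = c • (R *ᵥ olsBeta X y) := by
    rw [olsBeta_mulVec_add_smul hX, mulVec_add, mulVec_smul, hβ, add_sub_cancel_left]
  have hc2 : c ^ 2 ≠ 0 := pow_ne_zero 2 hc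
  unfold testStat
  rw [hv, omegaHat_mulVec_add_smul hn w hX, sub_zero, det_smul]
  have hiff : (c ^ 2) ^ Fintype.card (Fin q) * (omegaHat w X R y).det ≠ 0 ↔
      (omegaHat w X R y).det ≠ 0 := by
    rw [mul_ne_zero_iff, and_iff_right (pow_ne_zero _ hc2)]
  by_cases h : (omegaHat w X R y).det ≠ 0
  · rw [if_pos (hiff.mpr h), if_pos h]
    have hinv : (c ^ 2 • omegaHat w X R y)⁻¹ = (c ^ 2)⁻¹ • (omegaHat w X R y)⁻¹ :=
      inv_smul' _ (Units.mk0 _ hc2) (isUnit_iff_ne_zero.mpr h)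
    rw [hinv, smul_mulVec, mulVec_smul, dotProduct_smul, dotProduct_smul, smul_dotProduct]
    simp only [smul_eq_mul]
    field_simp
  · rw [if_neg (mt hiff.mp h), if_neg h]

/-! ### The exceptional set -/

theorem mulVec_add_mem_bSet_iff {n k q : ℕ} {X : Matrix (Fin n) (Fin k) ℝ} (hX : X.rank = k)
    (R : Matrix (Fin q) (Fin k) ℝ) (β : Fin k → ℝ) (y : Fin n → ℝ) :
    X *ᵥ β + y ∈ bSet X R ↔ y ∈ bSet X R := by
  have := bMatrix_mulVec_add_smul hX R β 1 y
  rw [one_smul, one_smul] at this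
  simp only [bSet, Set.mem_ofPred_eq, this]

theorem det_omegaHat_ne_zero {n k q : ℕ} (hn : n ≠ 0) {w : ℤ → ℝ} (hw : WeightAssumption n w)
    {X : Matrix (Fin n) (Fin k) ℝ} {R : Matrix (Fin q) (Fin k) ℝ} {y : Fin n → ℝ}
    (hy : y ∉ bSet X R) : (omegaHat w X R y).det ≠ 0 := by
  have hrank : (bMatrix X R y)ᵀ.rank = q := by
    rw [rank_transpose]
    exact le_antisymm ((rank_le_card_height _).trans_eq (Fintype.card_fin q)) (not_lt.mp hy)
  have hker : Function.Injective fun v => v ᵥ* bMatrix X R y := by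
    have h2 := (bMatrix X R y)ᵀ.mulVecLin.finrank_range_add_finrank_ker
    rw [← Matrix.rank, hrank, Module.finrank_fin_fun, Nat.add_eq_left,
      Submodule.finrank_eq_zero, LinearMap.ker_eq_bot] at h2
    intro a b hab
    exact h2 (by simpa only [mulVecLin_apply, mulVec_transpose] using hab)
  have hpd := hw.posDef.mul_mul_conjTranspose_same hker
  rw [conjTranspose_eq_transpose_of_trivial] at hpd
  rw [omegaHat_eq hn]
  exact hpd.det_pos.ne'

theorem testStat_zero {n k q : ℕ} (hn : n ≠ 0) (hq : 1 ≤ q) (w : ℤ → ℝ)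
    (X : Matrix (Fin n) (Fin k) ℝ) (R : Matrix (Fin q) (Fin k) ℝ) (r : Fin q → ℝ) :
    testStat w X R r 0 = 0 := by
  have : Nonempty (Fin q) := ⟨⟨0, hq⟩⟩
  have h : omegaHat w X R 0 = 0 := by simp [omegaHat_eq hn, bMatrix, olsResid, olsBeta]
  rw [testStat, h, det_zero, if_neg (not_not.mpr rfl)]

/-! ### Continuity and measurability -/

theorem continuous_olsBeta {n k : ℕ} (X : Matrix (Fin n) (Fin k) ℝ) :
    Continuous (olsBeta X) := by
  unfold olsBeta
  fun_prop

theorem continuous_omegaHat {n k q : ℕ} (hn : n ≠ 0) (w : ℤ → ℝ) (X : Matrix (Fin n) (Fin k) ℝ)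
    (R : Matrix (Fin q) (Fin k) ℝ) : Continuous (omegaHat w X R) := by
  have hres : Continuous (olsResid X) :=
    continuous_id.sub (continuous_const.matrix_mulVec (continuous_olsBeta X))
  have hb : Continuous (bMatrix X R) := continuous_const.matrix_mul hres.matrix_diagonal
  rw [funext (omegaHat_eq hn w X R)]
  fun_prop

theorem measurable_testStat {n k q : ℕ} (hn : n ≠ 0) (w : ℤ → ℝ) (X : Matrix (Fin n) (Fin k) ℝ)
    (R : Matrix (Fin q) (Fin k) ℝ) (r : Fin q → ℝ) : Measurable (testStat w X R r) := by
  have hΩ := continuous_omegaHat hn w X R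
  have hβ := continuous_olsBeta X
  have hv : Continuous fun y => R *ᵥ olsBeta X y - r := by fun_prop
  rw [funext (testStat_eq w X R r)]
  exact hΩ.matrix_det.measurable.inv.mul
    (hv.dotProduct (hΩ.matrix_adjugate.matrix_mulVec hv)).measurable

theorem continuousAt_testStat {n k q : ℕ} (hn : n ≠ 0) {w : ℤ → ℝ}
    {X : Matrix (Fin n) (Fin k) ℝ} {R : Matrix (Fin q) (Fin k) ℝ} (r : Fin q → ℝ)
    {y : Fin n → ℝ} (hy : (omegaHat w X R y).det ≠ 0) : ContinuousAt (testStat w X R r) y := by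
  have hΩ := continuous_omegaHat hn w X R
  have hβ := continuous_olsBeta X
  have hv : Continuous fun y => R *ᵥ olsBeta X y - r := by fun_prop
  rw [funext (testStat_eq w X R r)]
  exact (hΩ.matrix_det.continuousAt.inv₀ hy).mul
    (hv.dotProduct (hΩ.matrix_adjugate.matrix_mulVec hv)).continuousAt

/-! ### The singularity set of `Ω̂_w` is null -/

theorem bMatrix_add_smul {n k q : ℕ} (X : Matrix (Fin n) (Fin k) ℝ)
    (R : Matrix (Fin q) (Fin k) ℝ) (t : ℝ) (y v : Fin n → ℝ) :
    bMatrix X R (y + t • v) = bMatrix X R y + t • bMatrix X R v := by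
  have h : olsResid X (y + t • v) = olsResid X y + t • olsResid X v := by
    simp only [olsResid, olsBeta, mulVec_add, mulVec_smul, smul_sub]
    abel
  simp only [bMatrix, h, ← Matrix.mul_smul, ← Matrix.mul_add, ← diagonal_smul, diagonal_add]
  rfl

/-- `B` is linear in `y`, so the determinant is a polynomial in `t`; its behaviour as `t → ∞` is
governed by the nonzero determinant at `v`. -/
theorem finite_setOf_det_omegaHat_add_smul_eq_zero {n k q : ℕ} (hn : n ≠ 0) {w : ℤ → ℝ}
    {X : Matrix (Fin n) (Fin k) ℝ} (hX : X.rank = k) {R : Matrix (Fin q) (Fin k) ℝ}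
    {v : Fin n → ℝ} (hv : (omegaHat w X R v).det ≠ 0) (y : Fin n → ℝ) :
    {t : ℝ | (omegaHat w X R (y + t • v)).det = 0}.Finite := by
  let B : Matrix (Fin q) (Fin n) (Polynomial ℝ) :=
    (bMatrix X R y).map Polynomial.C + (Polynomial.X : Polynomial ℝ) •
      (bMatrix X R v).map Polynomial.C
  let p : Polynomial ℝ := (B * (weightMatrix n w).map Polynomial.C * Bᵀ).det
  have hp : ∀ t, p.eval t = (omegaHat w X R (y + t • v)).det := by
    intro t
    have hB : B.map (Polynomial.evalRingHom t) = bMatrix X R (y + t • v) := by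
      rw [bMatrix_add_smul]
      ext i j
      simp [B]
      ring
    rw [omegaHat_eq hn, ← Polynomial.coe_evalRingHom, RingHom.map_det, RingHom.mapMatrix_apply,
      Matrix.map_mul, Matrix.map_mul, transpose_map, hB]
    congr 3
    ext i j
    simp
  have hp0 : p ≠ 0 := by
    intro h0
    -- Inversion `t = s⁻¹` moves infinity to `s = 0`, where continuity contradicts `hv`.
    have hz : ∀ s : ℝ, s ≠ 0 → (omegaHat w X R (v + s • y)).det = 0 := by
      intro s hs
      have h1 := hp s⁻¹
      rw [h0, Polynomial.eval_zero] at h1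
      have h2 : v + s • y = X *ᵥ 0 + s • (y + s⁻¹ • v) := by
        rw [mulVec_zero, zero_add, smul_add, smul_smul, mul_inv_cancel₀ hs, one_smul, add_comm]
      rw [h2, omegaHat_mulVec_add_smul hn w hX, det_smul, ← h1, mul_zero]
    have hcont : Continuous fun s : ℝ => (omegaHat w X R (v + s • y)).det :=
      ((continuous_omegaHat hn w X R).comp (by fun_prop)).matrix_det
    have hlim : Tendsto (fun s : ℝ => (omegaHat w X R (v + s • y)).det) (𝓝[≠] 0) (𝓝 0) :=
      tendsto_const_nhds.congr' <| by
        filter_upwards [self_mem_nhdsWithin] with s hs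
        exact (hz s hs).symm
    have := tendsto_nhds_unique hlim (hcont.continuousAt.tendsto.mono_left nhdsWithin_le_nhds)
    rw [zero_smul, add_zero] at this
    exact hv this.symm
  refine (Polynomial.finite_setOfPred_isRoot hp0).subset fun t ht => ?_
  exact (hp t).trans ht

/-- Every line in direction `z₀` meets the zero set in finitely many points, so Fubini makes that
set null. -/
theorem ae_det_omegaHat_mulVec_ne_zero {n m k q : ℕ} (hn : n ≠ 0) {w : ℤ → ℝ}
    {X : Matrix (Fin n) (Fin k) ℝ} (hX : X.rank = k) {R : Matrix (Fin q) (Fin k) ℝ}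
    {A : Matrix (Fin n) (Fin m) ℝ} {z₀ : Fin m → ℝ} (hz₀ : (omegaHat w X R (A *ᵥ z₀)).det ≠ 0) :
    ∀ᵐ z : Fin m → ℝ, (omegaHat w X R (A *ᵥ z)).det ≠ 0 := by
  have hcont : Continuous fun z : Fin m → ℝ => (omegaHat w X R (A *ᵥ z)).det :=
    ((continuous_omegaHat hn w X R).comp (by fun_prop)).matrix_det
  refine ae_mem_of_ae_add_linearMap_mem (LinearMap.toSpanSingleton ℝ (Fin m → ℝ) z₀) volume volume
    (s := {z | (omegaHat w X R (A *ᵥ z)).det ≠ 0})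
    (hcont.measurable (measurableSet_singleton 0).compl) fun z => ?_
  rw [ae_iff]
  simp only [Set.mem_ofPred_eq, LinearMap.toSpanSingleton_apply, mulVec_add, mulVec_smul, not_not]
  exact (finite_setOf_det_omegaHat_add_smul_eq_zero hn hX hz₀ _).measure_zero _

section

attribute [local instance] Matrix.normedAddCommGroup Matrix.normedSpace

/-! ### Spectral representation of the covariance matrices -/

theorem eMatrix_zero_mul_transpose_apply {n : ℕ} (ω : ℝ) (i j : Fin n) :
    (eMatrix n 0 ω * (eMatrix n 0 ω)ᵀ) i j = Real.cos (((i : ℝ) - j) * ω) := by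
  have : ((i : ℝ) - j) * ω = ((i : ℝ) + 1) * ω - ((j : ℝ) + 1) * ω := by ring
  rw [this, Real.cos_sub]
  simp [eMatrix, mul_apply]

theorem specCov_apply {n : ℕ} {f : ℝ → ℝ} (hf : IsNormalizedSpectralDensity f) (i j : Fin n) :
    specCov n f i j = ∫ ω in Set.Icc (-Real.pi) Real.pi, f ω *
      Real.cos (((i : ℝ) - j) * |ω|) := by
  have hpi : -Real.pi ≤ Real.pi := by linarith [Real.pi_pos]
  have hint : IntervalIntegrable (fun ω => Complex.exp
      (-Complex.I * (((i : ℝ) - (j : ℝ) : ℝ) : ℂ) * (ω : ℂ)) * (f ω : ℂ)) volume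
      (-Real.pi) Real.pi := by
    have h1 : IntervalIntegrable (fun ω => (f ω : ℂ)) volume (-Real.pi) Real.pi := by
      rw [intervalIntegrable_iff_integrableOn_Icc_of_le hpi]
      exact hf.integrable.ofReal
    exact h1.continuousOn_mul (by fun_prop)
  have h := Complex.reCLM.intervalIntegral_comp_comm hint
  simp only [Complex.reCLM_apply] at h
  rw [specCov, of_apply, ← h, intervalIntegral.integral_of_le hpi, integral_Icc_eq_integral_Ioc]
  refine integral_congr_ae (ae_of_all _ fun ω => ?_)
  have habs : Real.cos (((i : ℝ) - j) * |ω|) = Real.cos (((i : ℝ) - j) * ω) := by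
    rcases abs_choice ω with h | h <;> rw [h]
    rw [mul_neg, Real.cos_neg]
  have hexp : -Complex.I * (((i : ℝ) - (j : ℝ) : ℝ) : ℂ) * (ω : ℂ)
      = ((-(((i : ℝ) - j) * ω) : ℝ) : ℂ) * Complex.I := by
    push_cast; ring
  simp only [habs, hexp, Complex.re_mul_ofReal, Complex.exp_ofReal_mul_I_re, Real.cos_neg]
  ring

theorem mul_specCov_mul_transpose_apply {n : ℕ} {f : ℝ → ℝ}
    (hf : IsNormalizedSpectralDensity f) (P : Matrix (Fin n) (Fin n) ℝ) (i j : Fin n) :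
    (P * specCov n f * Pᵀ) i j = ∫ ω in Set.Icc (-Real.pi) Real.pi,
      f ω * (P * eMatrix n 0 |ω| * (P * eMatrix n 0 |ω|)ᵀ) i j := by
  have hint : ∀ a b : Fin n, IntegrableOn
      (fun ω => f ω * Real.cos (((a : ℝ) - b) * |ω|) * P i a * P j b)
      (Set.Icc (-Real.pi) Real.pi) := fun a b =>
    ((hf.integrable.mul_continuousOn (by fun_prop) isCompact_Icc).mul_const _).mul_const _
  have hterm : ∀ ω, f ω * (P * eMatrix n 0 |ω| * (P * eMatrix n 0 |ω|)ᵀ) i j =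
      ∑ b : Fin n, ∑ a : Fin n, f ω * Real.cos (((a : ℝ) - b) * |ω|) * P i a * P j b := by
    intro ω
    have : P * eMatrix n 0 |ω| * (P * eMatrix n 0 |ω|)ᵀ =
        P * (eMatrix n 0 |ω| * (eMatrix n 0 |ω|)ᵀ) * Pᵀ := by
      simp only [transpose_mul, Matrix.mul_assoc]
    rw [this, mul_apply, Finset.mul_sum]
    refine Finset.sum_congr rfl fun b _ => ?_
    rw [mul_apply, Finset.sum_mul, Finset.mul_sum]
    refine Finset.sum_congr rfl fun a _ => ?_
    rw [eMatrix_zero_mul_transpose_apply, transpose_apply]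
    ring
  simp only [hterm]
  rw [integral_finsetSum _ fun b _ => integrable_finsetSum _ fun a _ => hint a b, mul_apply]
  refine Finset.sum_congr rfl fun b _ => ?_
  rw [integral_finsetSum _ fun a _ => hint a b, mul_apply, Finset.sum_mul]
  refine Finset.sum_congr rfl fun a _ => ?_
  rw [specCov_apply hf, integral_mul_const, integral_mul_const, transpose_apply]
  ring

/-- The scalar `c` is the total mass of `t dκ` and `S` the average of `G` under it, which stays in
the closed convex hull. For zero mass any `S` serves, hence the nonemptiness of `K`. -/
theorem exists_integral_smul_eq_smul_mem_convexHull {Ω E : Type*} [MeasurableSpace Ω]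
    [NormedAddCommGroup E] [NormedSpace ℝ E] [FiniteDimensional ℝ E] {κ : Measure Ω}
    {t : Ω → ℝ} {G : Ω → E} {K : Set E} (hK : IsCompact K) (hne : K.Nonempty)
    (hG : AEStronglyMeasurable G κ) (hmem : ∀ᵐ ω ∂κ, G ω ∈ K) (ht : Integrable t κ)
    (hnonneg : ∀ᵐ ω ∂κ, 0 ≤ t ω) :
    ∃ c : ℝ, 0 ≤ c ∧ ∃ S ∈ convexHull ℝ K, ∫ ω, t ω • G ω ∂κ = c • S := by
  have : CompleteSpace E := FiniteDimensional.complete ℝ E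
  let ν : Measure Ω := κ.withDensity fun ω => ENNReal.ofReal (t ω)
  have hac : ν ≪ κ := withDensity_absolutelyContinuous _ _
  have hfin : IsFiniteMeasure ν := isFiniteMeasure_withDensity_ofReal ht.2
  have hrep : ∫ ω, t ω • G ω ∂κ = ∫ ω, G ω ∂ν := by
    rw [integral_withDensity_eq_integral_toReal_smul₀ ht.aemeasurable.ennreal_ofReal
      (ae_of_all _ fun _ => ENNReal.ofReal_lt_top)]
    refine integral_congr_ae ?_
    filter_upwards [hnonneg] with ω hω
    rw [ENNReal.toReal_ofReal hω]
  by_cases hν : ν = 0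
  · obtain ⟨S, hS⟩ := hne
    refine ⟨0, le_rfl, S, subset_convexHull ℝ _ hS, ?_⟩
    rw [hrep, hν, integral_zero_measure, zero_smul]
  · have : NeZero ν := ⟨hν⟩
    have hav := (convex_convexHull ℝ K).average_mem (μ := ν) (f := G)
      (isCompact_convexHull_of_finiteDimensional hK).isClosed ?_ ?_
    · refine ⟨ν.real Set.univ, measureReal_nonneg, _, hav, ?_⟩
      rw [average_eq, smul_smul, mul_inv_cancel₀, one_smul, hrep]
      simpa [Measure.real, ENNReal.toReal_eq_zero_iff] using hν
    · filter_upwards [hac.ae_le hmem] with ω hω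
      exact subset_convexHull ℝ _ hω
    · obtain ⟨b, hb⟩ := hK.isBounded.exists_norm_le
      refine Integrable.of_bound (hG.mono_ac hac) b ?_
      filter_upwards [hac.ae_le hmem] with ω hω
      exact hb _ hω

/-- The convex hull of the normalized leading Gram matrices over `[0, π]`. -/
def leadHull {n : ℕ} (P : Matrix (Fin n) (Fin n) ℝ) : Set (Matrix (Fin n) (Fin n) ℝ) :=
  convexHull ℝ (leadGram P '' Set.Icc 0 Real.pi)

theorem isCompact_leadHull {n : ℕ} {P : Matrix (Fin n) (Fin n) ℝ}
    (hP : LinearMap.ker P.mulVecLin ≠ ⊤) : IsCompact (leadHull P) :=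
  isCompact_convexHull_of_finiteDimensional (isCompact_Icc.image (continuous_leadGram hP))

theorem exists_mul_specCov_mul_transpose_eq_smul {n : ℕ} {P : Matrix (Fin n) (Fin n) ℝ}
    (hP : LinearMap.ker P.mulVecLin ≠ ⊤) {f : ℝ → ℝ} (hf : IsNormalizedSpectralDensity f) :
    ∃ c : ℝ, 0 ≤ c ∧ ∃ S ∈ leadHull P, P * specCov n f * Pᵀ = c • S := by
  let t : ℝ → ℝ := fun ω => (P * eMatrix n 0 |ω| * (P * eMatrix n 0 |ω|)ᵀ).trace
  let κ : Measure ℝ := volume.restrict (Set.Icc (-Real.pi) Real.pi)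
  let G : ℝ → Fin n → Fin n → ℝ := fun ω => leadGram P |ω|
  have hE : Continuous fun ω : ℝ => P * eMatrix n 0 |ω| :=
    continuous_const.matrix_mul ((continuous_eMatrix n 0).comp continuous_abs)
  have ht : Continuous t := (hE.matrix_mul hE.matrix_transpose).matrix_trace
  have hint : Integrable (fun ω => f ω * t ω) κ :=
    hf.integrable.mul_continuousOn ht.continuousOn isCompact_Icc
  have hnonneg : ∀ᵐ ω ∂κ, 0 ≤ f ω * t ω := by
    filter_upwards [ae_restrict_mem measurableSet_Icc] with ω hω
    exact mul_nonneg (hf.nonneg ω hω) (trace_mul_transpose_nonneg _)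
  have hG : Continuous G := (continuous_leadGram hP).comp continuous_abs
  let K : Set (Fin n → Fin n → ℝ) := leadGram P '' Set.Icc 0 Real.pi
  have hK : IsCompact K := isCompact_Icc.image (continuous_leadGram hP)
  have hmem : ∀ᵐ ω ∂κ, G ω ∈ K := by
    filter_upwards [ae_restrict_mem measurableSet_Icc] with ω hω
    exact ⟨|ω|, ⟨abs_nonneg _, abs_le.mpr hω⟩, rfl⟩
  obtain ⟨c, hc, S, hS, h⟩ := exists_integral_smul_eq_smul_mem_convexHull hK
    ⟨_, 0, ⟨le_rfl, Real.pi_pos.le⟩, rfl⟩ hG.aestronglyMeasurable hmem hint hnonneg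
  refine ⟨c, hc, S, hS, ?_⟩
  obtain ⟨b, hb⟩ := hK.isBounded.exists_norm_le
  have hintG : Integrable (fun ω => (f ω * t ω) • G ω) κ :=
    hint.smul_bdd b hG.aestronglyMeasurable (hmem.mono fun ω hω => hb _ hω)
  ext i j
  have hij := congrFun (congrFun h i) j
  rw [eval_integral fun i => hintG.eval i, eval_integral fun j => (hintG.eval i).eval j] at hij
  rw [mul_specCov_mul_transpose_apply hf]
  refine Eq.trans (integral_congr_ae (ae_of_all _ fun ω => ?_)) hij
  dsimp only
  rw [← trace_smul_leadGram P |ω|]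
  change f ω * (t ω * G ω i j) = f ω * t ω * G ω i j
  ring

/-! ### Elements of the hull -/

theorem dotProduct_mul_transpose_mulVec {n m : ℕ} (V : Matrix (Fin n) (Fin m) ℝ)
    (x : Fin n → ℝ) : x ⬝ᵥ ((V * Vᵀ) *ᵥ x) = (Vᵀ *ᵥ x) ⬝ᵥ (Vᵀ *ᵥ x) := by
  rw [← mulVec_mulVec, dotProduct_mulVec, ← mulVec_transpose]

theorem dotProduct_self_nonneg_real {m : ℕ} (v : Fin m → ℝ) : 0 ≤ v ⬝ᵥ v :=
  Finset.sum_nonneg fun i _ => mul_self_nonneg (v i)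

theorem isSymm_of_mem_leadHull {n : ℕ} {P S : Matrix (Fin n) (Fin n) ℝ} (hS : S ∈ leadHull P) :
    Sᵀ = S := by
  have hconv : Convex ℝ {S : Matrix (Fin n) (Fin n) ℝ | Sᵀ = S} := by
    intro A hA B hB a b _ _ _
    simp only [Set.mem_ofPred_eq] at hA hB ⊢
    rw [transpose_add, transpose_smul, transpose_smul, hA, hB]
  refine convexHull_min ?_ hconv hS
  rintro _ ⟨γ, -, rfl⟩
  simp [leadGram, normGram]

theorem trace_of_mem_leadHull {n : ℕ} {P S : Matrix (Fin n) (Fin n) ℝ}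
    (hP : LinearMap.ker P.mulVecLin ≠ ⊤) (hS : S ∈ leadHull P) : S.trace = 1 := by
  have hconv : Convex ℝ {S : Matrix (Fin n) (Fin n) ℝ | S.trace = 1} := by
    intro A hA B hB a b _ _ hab
    simp only [Set.mem_ofPred_eq] at hA hB ⊢
    rw [trace_add, trace_smul, trace_smul, hA, hB, smul_eq_mul, smul_eq_mul, mul_one, mul_one, hab]
  refine convexHull_min ?_ hconv hS
  rintro _ ⟨γ, -, rfl⟩
  exact trace_normGram (mul_eMatrix_rho_ne_zero hP γ)

/-- A convex combination keeps a generator with positive weight, and the remaining terms are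
nonnegative. Both properties are carried together because the second is not convex alone. -/
theorem exists_lower_bound_of_mem_leadHull {n : ℕ} {P S : Matrix (Fin n) (Fin n) ℝ}
    (hS : S ∈ leadHull P) : (∀ x, 0 ≤ x ⬝ᵥ (S *ᵥ x)) ∧
      ∃ γ ∈ Set.Icc 0 Real.pi, ∃ c : ℝ, 0 < c ∧
        ∀ x, c * (x ⬝ᵥ (leadGram P γ *ᵥ x)) ≤ x ⬝ᵥ (S *ᵥ x) := by
  have hconv : Convex ℝ {S : Matrix (Fin n) (Fin n) ℝ | (∀ x, 0 ≤ x ⬝ᵥ (S *ᵥ x)) ∧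
      ∃ γ ∈ Set.Icc 0 Real.pi, ∃ c : ℝ, 0 < c ∧
        ∀ x, c * (x ⬝ᵥ (leadGram P γ *ᵥ x)) ≤ x ⬝ᵥ (S *ᵥ x)} := by
    rintro A ⟨hA, γ, hγ, c, hc, hcA⟩ B ⟨hB, γ', hγ', c', hc', hcB⟩ a b ha hb hab
    simp only [Set.mem_ofPred_eq, add_mulVec, smul_mulVec, dotProduct_add, dotProduct_smul,
      smul_eq_mul]
    refine ⟨fun x => add_nonneg (mul_nonneg ha (hA x)) (mul_nonneg hb (hB x)), ?_⟩
    rcases ha.eq_or_lt with rfl | ha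
    · rw [zero_add] at hab
      subst hab
      exact ⟨γ', hγ', c', hc', fun x => by simpa using hcB x⟩
    · refine ⟨γ, hγ, a * c, mul_pos ha hc, fun x => ?_⟩
      rw [mul_assoc]
      exact (mul_le_mul_of_nonneg_left (hcA x) ha.le).trans
        (le_add_of_nonneg_right (mul_nonneg hb (hB x)))
  refine convexHull_min ?_ hconv hS
  rintro _ ⟨γ, hγ, rfl⟩
  refine ⟨fun x => ?_, γ, hγ, 1, one_pos, fun x => (one_mul _).le⟩
  rw [leadGram, normGram, smul_mulVec, dotProduct_smul, smul_eq_mul,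
    dotProduct_mul_transpose_mulVec]
  exact mul_nonneg (inv_nonneg.mpr (trace_mul_transpose_nonneg _)) (dotProduct_self_nonneg_real _)

/-- Duality: the kernel of a transpose is the annihilator of the column space. -/
theorem colSpan_le_of_transpose_mulVec {n m l : ℕ} {A : Matrix (Fin n) (Fin m) ℝ}
    {V : Matrix (Fin n) (Fin l) ℝ} (h : ∀ x, Aᵀ *ᵥ x = 0 → Vᵀ *ᵥ x = 0) :
    colSpan V ≤ colSpan A := by
  intro v hv
  by_contra hvA
  obtain ⟨φ, hφv, hφA⟩ := Submodule.exists_le_ker_of_notMem hvA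
  obtain ⟨x, rfl⟩ := (dotProductEquiv ℝ (Fin n)).surjective φ
  have hx : ∀ w, dotProductEquiv ℝ (Fin n) x w = x ⬝ᵥ w := fun w => rfl
  have hA : Aᵀ *ᵥ x = 0 := by
    refine dotProduct_eq_zero _ fun b => ?_
    rw [mulVec_transpose, ← dotProduct_mulVec, ← hx]
    exact hφA (mem_colSpan.mpr ⟨b, rfl⟩)
  obtain ⟨b, rfl⟩ := mem_colSpan.mp hv
  rw [hx, dotProduct_mulVec, ← mulVec_transpose, h x hA, zero_dotProduct] at hφv
  exact hφv rfl

theorem exists_colSpan_le_of_mul_transpose_mem_leadHull {n m : ℕ}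
    {P : Matrix (Fin n) (Fin n) ℝ} (hP : LinearMap.ker P.mulVecLin ≠ ⊤)
    {A : Matrix (Fin n) (Fin m) ℝ} (hA : A * Aᵀ ∈ leadHull P) :
    ∃ γ ∈ Set.Icc 0 Real.pi,
      colSpan (P * eMatrix n (rho γ (LinearMap.ker P.mulVecLin)) γ) ≤ colSpan A := by
  obtain ⟨-, γ, hγ, c, hc, hle⟩ := exists_lower_bound_of_mem_leadHull hA
  refine ⟨γ, hγ, colSpan_le_of_transpose_mulVec fun x hx => ?_⟩
  set V := P * eMatrix n (rho γ (LinearMap.ker P.mulVecLin)) γ with hV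
  have htr : 0 < (V * Vᵀ).trace := lt_of_le_of_ne (trace_mul_transpose_nonneg V) fun h =>
    mul_eMatrix_rho_ne_zero hP γ ((trace_mul_transpose_eq_zero_iff V).mp h.symm)
  have h := hle x
  rw [dotProduct_mul_transpose_mulVec, hx, dotProduct_zero, leadGram, ← hV, normGram, smul_mulVec,
    dotProduct_smul, smul_eq_mul, dotProduct_mul_transpose_mulVec, ← mul_assoc] at h
  have h0 := nonpos_of_mul_nonpos_right h (mul_pos hc (inv_pos.mpr htr))
  exact dotProduct_self_eq_zero.mp (le_antisymm h0 (dotProduct_self_nonneg_real _))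

/-- Elements of the hull have trace one, so all entries of `A` lie in `[-1, 1]`. -/
theorem isCompact_setOf_mul_transpose_mem_leadHull {n : ℕ} {P : Matrix (Fin n) (Fin n) ℝ}
    (hP : LinearMap.ker P.mulVecLin ≠ ⊤) :
    IsCompact {A : Matrix (Fin n) (Fin n) ℝ | A * Aᵀ ∈ leadHull P} := by
  have hbox : IsCompact (Set.univ.pi fun _ : Fin n => Set.univ.pi fun _ : Fin n =>
      Set.Icc (-1 : ℝ) 1) :=
    isCompact_univ_pi fun _ => isCompact_univ_pi fun _ => isCompact_Icc
  refine hbox.of_isClosed_subset ((isCompact_leadHull hP).isClosed.preimage (by fun_prop)) ?_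
  intro A hA i _ j _
  have h := sq_le_trace_mul_transpose A i j
  rw [trace_of_mem_leadHull hP hA] at h
  exact abs_le.mp ((sq_le_one_iff_abs_le_one _).mp h)

/-! ### Square roots of the covariance matrices -/

theorem posSemidef_specCov {n : ℕ} (hn : n ≠ 0) {f : ℝ → ℝ}
    (hf : IsNormalizedSpectralDensity f) : (specCov n f).PosSemidef := by
  have : Nonempty (Fin n) := ⟨⟨0, Nat.pos_of_ne_zero hn⟩⟩
  have h1 : LinearMap.ker (1 : Matrix (Fin n) (Fin n) ℝ).mulVecLin ≠ ⊤ := by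
    rw [mulVecLin_one, LinearMap.ker_id]
    exact bot_ne_top
  obtain ⟨c, hc, S, hS, h⟩ := exists_mul_specCov_mul_transpose_eq_smul h1 hf
  rw [Matrix.one_mul, transpose_one, Matrix.mul_one] at h
  rw [h]
  refine PosSemidef.smul (PosSemidef.of_dotProduct_mulVec_nonneg ?_ fun x => ?_) hc
  · rw [IsHermitian, conjTranspose_eq_transpose_of_trivial, isSymm_of_mem_leadHull hS]
  · rw [star_trivial]
    exact (exists_lower_bound_of_mem_leadHull hS).1 x

theorem matSqrt_mul_transpose {n : ℕ} {S : Matrix (Fin n) (Fin n) ℝ} (hS : S.PosSemidef) :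
    matSqrt S * (matSqrt S)ᵀ = S := by
  open scoped MatrixOrder in
  have h1 : (matSqrt S).PosSemidef := nonneg_iff_posSemidef.mp (CFC.sqrt_nonneg S)
  have h2 : (matSqrt S)ᵀ = matSqrt S := by
    rw [← conjTranspose_eq_transpose_of_trivial]
    exact h1.isHermitian
  rw [h2]
  open scoped MatrixOrder in
  exact CFC.sqrt_mul_sqrt_self S (nonneg_iff_posSemidef.mpr hS)

/-- The rotation `U` cancels in the Gram matrix, so factors with arbitrary `U` fall into the same
compact set. -/
theorem exists_mul_matSqrt_mul_eq_smul {n : ℕ} (hn : n ≠ 0) {P : Matrix (Fin n) (Fin n) ℝ}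
    (hP : LinearMap.ker P.mulVecLin ≠ ⊤) {f : ℝ → ℝ} (hf : IsNormalizedSpectralDensity f)
    {U : Matrix (Fin n) (Fin n) ℝ} (hU : U * Uᵀ = 1) :
    P * (matSqrt (specCov n f) * U) = 0 ∨ ∃ c : ℝ, 0 < c ∧ ∃ A : Matrix (Fin n) (Fin n) ℝ,
      A * Aᵀ ∈ leadHull P ∧ P * (matSqrt (specCov n f) * U) = c • A := by
  set M := P * (matSqrt (specCov n f) * U) with hM
  have hMM : M * Mᵀ = P * specCov n f * Pᵀ := by
    have h : M * Mᵀ = P * (matSqrt (specCov n f) * (U * Uᵀ) * (matSqrt (specCov n f))ᵀ) * Pᵀ := by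
      rw [hM]
      simp only [transpose_mul, Matrix.mul_assoc]
    rw [h, hU, Matrix.mul_one, matSqrt_mul_transpose (posSemidef_specCov hn hf)]
  obtain ⟨c, hc, S, hS, h⟩ := exists_mul_specCov_mul_transpose_eq_smul hP hf
  rcases hc.eq_or_lt with rfl | hc
  · left
    rw [← trace_mul_transpose_eq_zero_iff, hMM, h, zero_smul, trace_zero]
  · right
    have hs := Real.sqrt_pos.mpr hc
    refine ⟨√c, hs, (√c)⁻¹ • M, ?_, ?_⟩
    · rw [transpose_smul, Matrix.smul_mul, Matrix.mul_smul, smul_smul, hMM, h, smul_smul,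
        ← mul_inv, Real.mul_self_sqrt hc.le, inv_mul_cancel₀ hc.ne', one_smul]
      exact hS
    · rw [smul_smul, mul_inv_cancel₀ hs.ne', one_smul]

end

/-! ### The direction of the null space -/

theorem exists_mulVec_eq_of_mem_nullMeansLin {n k q : ℕ} {X : Matrix (Fin n) (Fin k) ℝ}
    {R : Matrix (Fin q) (Fin k) ℝ} {r : Fin q → ℝ} {l : Fin n → ℝ}
    (hl : l ∈ nullMeansLin X R r) : ∃ β, X *ᵥ β = l ∧ R *ᵥ β = 0 := by
  have hle : nullMeansLin X R r ≤ (LinearMap.ker R.mulVecLin).map X.mulVecLin := by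
    refine Submodule.span_le.mpr ?_
    rintro _ ⟨_, ⟨β, rfl, hβ⟩, _, ⟨β', rfl, hβ'⟩, rfl⟩
    refine ⟨β - β', ?_, ?_⟩
    · simp [mulVec_sub, hβ, hβ']
    · simp [mulVec_sub]
  obtain ⟨β, hβ, rfl⟩ := hle hl
  exact ⟨β, rfl, hβ⟩

theorem finrank_colSpan {n m : ℕ} (A : Matrix (Fin n) (Fin m) ℝ) :
    Module.finrank ℝ (colSpan A) = A.rank := A.rank_eq_finrank_span_cols.symm

theorem nullMeansLin_ne_top {n k q : ℕ} (hkn : k < n) {X : Matrix (Fin n) (Fin k) ℝ}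
    (hX : X.rank = k) (R : Matrix (Fin q) (Fin k) ℝ) (r : Fin q → ℝ) :
    nullMeansLin X R r ≠ ⊤ := by
  intro h
  have hle : nullMeansLin X R r ≤ colSpan X := fun l hl => by
    obtain ⟨β, hβ, -⟩ := exists_mulVec_eq_of_mem_nullMeansLin hl
    exact mem_colSpan.mpr ⟨β, hβ⟩
  have := Submodule.finrank_mono hle
  rw [h, finrank_top, Module.finrank_fin_fun, finrank_colSpan, hX] at this
  omega

theorem exists_matrix_ker_eq {n : ℕ} (L : Submodule ℝ (Fin n → ℝ)) :
    ∃ P : Matrix (Fin n) (Fin n) ℝ, LinearMap.ker P.mulVecLin = L ∧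
      ∀ y, y - P *ᵥ y ∈ L := by
  -- `P` is the quotient map by `L` followed by a linear section.
  obtain ⟨s, hs⟩ := L.mkQ.exists_rightInverse_of_surjective L.range_mkQ
  have hs' : ∀ x, L.mkQ (s x) = x := LinearMap.congr_fun hs
  have hP : (LinearMap.toMatrix' (s ∘ₗ L.mkQ)).mulVecLin = s ∘ₗ L.mkQ := Matrix.toLin'_toMatrix' _
  refine ⟨LinearMap.toMatrix' (s ∘ₗ L.mkQ), ?_, fun y => ?_⟩
  · rw [hP, LinearMap.ker_comp_of_ker_eq_bot, Submodule.ker_mkQ]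
    exact LinearMap.ker_eq_bot.mpr (Function.LeftInverse.injective hs')
  · rw [← mulVecLin_apply, hP, ← Submodule.Quotient.eq]
    exact (hs' _).symm

/-! ### Uniform tightness over compact sets of matrices -/

/-- Otherwise there are bad matrices for the thresholds `m + 1`, converging along a subsequence to
some `A₀`. For almost every `z` the statistic converges to a finite value, so the rejection
indicators tend to zero, and `g` dominates. -/
theorem exists_forall_setLIntegral_le {n k q : ℕ} (hn : n ≠ 0) {w : ℤ → ℝ}
    {X : Matrix (Fin n) (Fin k) ℝ} {R : Matrix (Fin q) (Fin k) ℝ} (r : Fin q → ℝ)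
    {𝒜 : Set (Matrix (Fin n) (Fin n) ℝ)} (h𝒜 : IsCompact 𝒜)
    (hae : ∀ A ∈ 𝒜, ∀ᵐ z : Fin n → ℝ, (omegaHat w X R (A *ᵥ z)).det ≠ 0)
    {g : (Fin n → ℝ) → ℝ≥0∞} (hg : Measurable g) (hgint : ∫⁻ z, g z ≠ ∞)
    {ε : ℝ≥0∞} (hε : 0 < ε) :
    ∃ C : ℝ, 0 < C ∧ ∀ A ∈ 𝒜, ∫⁻ z in {z | C ≤ testStat w X R r (A *ᵥ z)}, g z ≤ ε := by
  by_contra! hcon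
  have : FirstCountableTopology (Matrix (Fin n) (Fin n) ℝ) :=
    inferInstanceAs (FirstCountableTopology (Fin n → Fin n → ℝ))
  choose A hA hlt using fun m : ℕ => hcon ((m : ℝ) + 1) (by positivity)
  obtain ⟨A₀, hA₀, φ, hφ, hlim⟩ := h𝒜.tendsto_subseq hA
  have hmeas : ∀ m : ℕ, MeasurableSet {z | ((m : ℝ) + 1) ≤ testStat w X R r (A m *ᵥ z)} :=
    fun m => measurableSet_le measurable_const
      ((measurable_testStat hn w X R r).comp (by fun_prop : Continuous _).measurable)
  have htend := tendsto_lintegral_of_dominated_convergence (μ := volume)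
    (F := fun m => {z | ((φ m : ℝ) + 1) ≤ testStat w X R r (A (φ m) *ᵥ z)}.indicator g)
    (f := fun _ => 0) g (fun m => hg.indicator (hmeas _))
    (fun m => ae_of_all _ fun z => Set.indicator_le_self _ _ _) hgint ?_
  · rw [lintegral_zero] at htend
    obtain ⟨m, hm⟩ := (htend.eventually (gt_mem_nhds hε)).exists
    rw [lintegral_indicator (hmeas _)] at hm
    exact lt_irrefl _ (hm.trans (hlt _))
  · filter_upwards [hae A₀ hA₀] with z hz
    have hAz : Tendsto (fun m => A (φ m) *ᵥ z) atTop (𝓝 (A₀ *ᵥ z)) :=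
      ((by fun_prop : Continuous fun B : Matrix (Fin n) (Fin n) ℝ => B *ᵥ z).tendsto A₀).comp hlim
    have hT := (continuousAt_testStat hn r hz).tendsto.comp hAz
    have hbig : Tendsto (fun m => (φ m : ℝ) + 1) atTop atTop :=
      tendsto_atTop_add_const_right _ _ (tendsto_natCast_atTop_atTop.comp hφ.tendsto_atTop)
    refine tendsto_const_nhds.congr' ?_
    filter_upwards [hT.eventually (gt_mem_nhds (lt_add_one _)),
      hbig.eventually_ge_atTop (testStat w X R r (A₀ *ᵥ z) + 1)] with m h1 h2
    have hz' : z ∉ {z | ((φ m : ℝ) + 1) ≤ testStat w X R r (A (φ m) *ᵥ z)} := fun h3 =>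
      absurd (h1.trans_le (h2.trans h3)) (lt_irrefl _)
    exact (Set.indicator_of_notMem hz' g).symm

/-! ### Size control -/

/-- A vector of the span of `E_{n,ρ}` outside the exceptional set differs from its image under `P`
only by an element of the span of `X`, to which that set is insensitive; the image lies in the span
of `A`. -/
theorem ae_det_omegaHat_ne_zero_of_nonInclusion {n k q : ℕ} (hkn : k < n)
    {X : Matrix (Fin n) (Fin k) ℝ} (hX : X.rank = k) {R : Matrix (Fin q) (Fin k) ℝ}
    {r : Fin q → ℝ} {w : ℤ → ℝ} (hw : WeightAssumption n w) (hinc : NonInclusion X R r)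
    {P : Matrix (Fin n) (Fin n) ℝ} (hker : LinearMap.ker P.mulVecLin = nullMeansLin X R r)
    (hP : ∀ y, y - P *ᵥ y ∈ nullMeansLin X R r) {A : Matrix (Fin n) (Fin n) ℝ}
    (hA : A * Aᵀ ∈ leadHull P) :
    ∀ᵐ z : Fin n → ℝ, (omegaHat w X R (A *ᵥ z)).det ≠ 0 := by
  have hn : n ≠ 0 := by omega
  have htop : LinearMap.ker P.mulVecLin ≠ ⊤ := hker ▸ nullMeansLin_ne_top hkn hX R r
  obtain ⟨γ, hγ, hle⟩ := exists_colSpan_le_of_mul_transpose_mem_leadHull htop hA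
  rw [hker] at hle
  obtain ⟨y, hy, hyB⟩ := Set.not_subset.mp (hinc γ hγ)
  obtain ⟨b, rfl⟩ := mem_colSpan.mp hy
  obtain ⟨z₀, hz₀⟩ := mem_colSpan.mp (hle (mem_colSpan.mpr ⟨b, rfl⟩))
  refine ae_det_omegaHat_mulVec_ne_zero hn hX (z₀ := z₀) (det_omegaHat_ne_zero hn hw fun hB => ?_)
  obtain ⟨β, hβ, -⟩ := exists_mulVec_eq_of_mem_nullMeansLin
    (hP (eMatrix n (rho γ (nullMeansLin X R r)) γ *ᵥ b))
  apply hyB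
  rw [hz₀, ← mulVec_mulVec, ← mulVec_add_mem_bSet_iff hX R β, hβ, sub_add_cancel] at hB
  exact hB

theorem testStat_add_smul_eq {n k q : ℕ} (hn : n ≠ 0) (w : ℤ → ℝ) {X : Matrix (Fin n) (Fin k) ℝ}
    (hX : X.rank = k) {R : Matrix (Fin q) (Fin k) ℝ} {r : Fin q → ℝ}
    {P : Matrix (Fin n) (Fin n) ℝ} (hP : ∀ y, y - P *ᵥ y ∈ nullMeansLin X R r)
    {μ : Fin n → ℝ} (hμ : μ ∈ nullMeans X R r) {σ : ℝ} (hσ : σ ≠ 0) (y : Fin n → ℝ) :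
    testStat w X R r (μ + σ • y) = testStat w X R 0 (P *ᵥ y) := by
  obtain ⟨β, rfl, hβ⟩ := hμ
  rw [testStat_mulVec_add_smul hn w hX hβ hσ]
  obtain ⟨β', hβ', hR⟩ := exists_mulVec_eq_of_mem_nullMeansLin (hP y)
  have := testStat_mulVec_add_smul hn w hX hR one_ne_zero (P *ᵥ y)
  rwa [hβ', one_smul, sub_add_cancel] at this

theorem exists_sizeAll_le {n k q : ℕ} (hkn : k < n) (hq : 1 ≤ q)
    {X : Matrix (Fin n) (Fin k) ℝ} (hX : X.rank = k) (R : Matrix (Fin q) (Fin k) ℝ)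
    (r : Fin q → ℝ) {w : ℤ → ℝ} (hw : WeightAssumption n w)
    {H : Set ((Fin n → ℝ) → ℝ)} (hEnv : HasIntegrableEnvelope H)
    {D : Set (((Fin n → ℝ) → ℝ) × Matrix (Fin n) (Fin n) ℝ)}
    (hD : D ⊆ H ×ˢ (Matrix.orthogonalGroup (Fin n) ℝ : Set (Matrix (Fin n) (Fin n) ℝ)))
    (hinc : NonInclusion X R r) {ε : ℝ≥0∞} (hε : 0 < ε) :
    ∃ C : ℝ, sizeAll X R r D {y | C ≤ testStat w X R r y} ≤ ε := by
  have hn : n ≠ 0 := by omega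
  obtain ⟨P, hker, hP⟩ := exists_matrix_ker_eq (nullMeansLin X R r)
  have htop : LinearMap.ker P.mulVecLin ≠ ⊤ := hker ▸ nullMeansLin_ne_top hkn hX R r
  obtain ⟨g, hg, hgint, hgH⟩ := hEnv
  obtain ⟨C, hC, hbound⟩ := exists_forall_setLIntegral_le hn (0 : Fin q → ℝ)
    (isCompact_setOf_mul_transpose_mem_leadHull htop)
    (fun A hA => ae_det_omegaHat_ne_zero_of_nonInclusion hkn hX hw hinc hker hP hA) hg hgint hε
  refine ⟨C, ?_⟩
  simp only [sizeAll, iSup_le_iff]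
  rintro ⟨h, U⟩ hhU μ hμ σ hσ f hf
  obtain ⟨hh, hU⟩ := hD hhU
  have hT : MeasurableSet {y | C ≤ testStat w X R r y} :=
    measurableSet_le measurable_const (measurable_testStat hn w X R r)
  have hmap : Measurable fun z : Fin n → ℝ => μ + σ • ((matSqrt (specCov n f) * U) *ᵥ z) :=
    (by fun_prop : Continuous _).measurable
  rw [lawQ, Measure.map_apply hmap hT]
  have hpre : (fun z : Fin n → ℝ => μ + σ • ((matSqrt (specCov n f) * U) *ᵥ z)) ⁻¹'
      {y | C ≤ testStat w X R r y} =
      {z | C ≤ testStat w X R 0 ((P * (matSqrt (specCov n f) * U)) *ᵥ z)} := by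
    ext z
    simp only [Set.mem_preimage, Set.mem_ofPred_eq]
    rw [testStat_add_smul_eq hn w hX hP hμ (ne_of_gt hσ), mulVec_mulVec]
  rw [hpre]
  rcases exists_mul_matSqrt_mul_eq_smul hn htop hf (((mem_orthogonalGroup_iff _ _).mp hU)) with
    h0 | ⟨c, hc, A, hA, hcA⟩
  -- Degenerate case: the statistic is identically zero, and `C` was chosen positive.
  · rw [h0]
    simp [testStat_zero hn hq, not_le.mpr hC]
  · have hscale : ∀ z : Fin n → ℝ,
        testStat w X R 0 ((c • A) *ᵥ z) = testStat w X R 0 (A *ᵥ z) := by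
      intro z
      have := testStat_mulVec_add_smul hn w hX (mulVec_zero R) hc.ne' (A *ᵥ z)
      rwa [mulVec_zero, zero_add, ← smul_mulVec] at this
    simp only [hcA, hscale]
    have hS : MeasurableSet {z | C ≤ testStat w X R 0 (A *ᵥ z)} :=
      measurableSet_le measurable_const
        ((measurable_testStat hn w X R 0).comp (by fun_prop : Continuous _).measurable)
    rw [densityLaw, withDensity_apply _ hS]
    exact (lintegral_mono_ae (ae_restrict_of_ae (hgH h hh))).trans (hbound A hA)

/-! ### The rank condition -/

/-- The rank of `(X, E)` is the dimension of the sum of the two column spaces. -/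
theorem lt_rank_fromCols_iff {n k m : ℕ} {X : Matrix (Fin n) (Fin k) ℝ} (hX : X.rank = k)
    (E : Matrix (Fin n) (Fin m) ℝ) :
    k < (fromCols X E).rank ↔ ¬ colSpan E ≤ colSpan X := by
  have hsup : Submodule.span ℝ (Set.range (fromCols X E).col) = colSpan X ⊔ colSpan E := by
    rw [colSpan, colSpan, ← Submodule.span_union]
    congr 1
    ext v
    simp only [Set.mem_range, Set.mem_union, Sum.exists]
    rfl
  rw [rank_eq_finrank_span_cols, hsup]
  constructor
  · intro h hle
    rw [sup_eq_left.mpr hle, finrank_colSpan, hX] at h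
    exact lt_irrefl _ h
  · intro h
    have hlt : colSpan X < colSpan X ⊔ colSpan E := left_lt_sup.mpr h
    have := Submodule.finrank_lt_finrank_of_lt hlt
    rwa [finrank_colSpan, hX] at this

theorem nonInclusion_iff_rankCondition {n k q : ℕ} {X : Matrix (Fin n) (Fin k) ℝ}
    (hX : X.rank = k) {R : Matrix (Fin q) (Fin k) ℝ} (r : Fin q → ℝ)
    (hB : bSet X R = (colSpan X : Set (Fin n → ℝ))) :
    NonInclusion X R r ↔ RankCondition X R r := by
  unfold NonInclusion RankCondition
  simp only [hB, SetLike.coe_subset_coe, lt_rank_fromCols_iff hX]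

end

end HAR

theorem mainTheorem12 {n k q : ℕ} (hk : 1 ≤ k) (hkn : k < n) (hq : 1 ≤ q)
    (X : Matrix (Fin n) (Fin k) ℝ) (hX : X.rank = k)
    (R : Matrix (Fin q) (Fin k) ℝ) (hR : R.rank = q) (r : Fin q → ℝ)
    (w : ℤ → ℝ) (hw : HAR.WeightAssumption n w) (hXR : HAR.DesignAssumption X R)
    (H : Set ((Fin n → ℝ) → ℝ)) (hH : ∀ h ∈ H, HAR.IsStandardizedDensity h)
    (hEnv : HAR.HasIntegrableEnvelope H)
    (D : Set (((Fin n → ℝ) → ℝ) × Matrix (Fin n) (Fin n) ℝ))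
    (hD : D ⊆ H ×ˢ (Matrix.orthogonalGroup (Fin n) ℝ : Set (Matrix (Fin n) (Fin n) ℝ))) :
    (HAR.NonInclusion X R r →
      ∀ α : ℝ, 0 < α → α < 1 →
        ∃ C : ℝ, HAR.sizeAll X R r D {y | C ≤ HAR.testStat w X R r y} ≤ ENNReal.ofReal α) ∧
    (HAR.bSet X R = (HAR.colSpan X : Set (Fin n → ℝ)) →
      (HAR.NonInclusion X R r ↔ HAR.RankCondition X R r)) :=
  ⟨fun hinc _ hα _ => HAR.exists_sizeAll_le hkn hq hX R r hw hEnv hD hinc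
    (ENNReal.ofReal_pos.mpr hα), HAR.nonInclusion_iff_rankCondition hX r⟩
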